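/- Let $\mathbb{CP}^2$ carry the Fubini–Study symplectic form $\omega$, normalized so that the total volume is $\pi^2/2$, and let $S^1$ act by $e^{i\theta}\cdot[z_0:z_1:z_2]=[z_0:z_1:e^{i\theta}z_2]$, with moment map $$\mu_2[z_0:z_1:z_2]=-\frac12\,\frac{|z_2|^2}{|z_0|^2+|z_1|^2+|z_2|^2}.$$ Identify the reduced space $M_{red}=\mu_2^{-1}(-\tfrac16)/S^1$ with $\mathbb{CP}^1$ by sending the orbit of $[z_0:z_1:z_2]$ to $[z_0:z_1]$, and let $\pi:\mu_2^{-1}(-\tfrac16)\to M_{red}$ be the projection. Let $\mu_{red}:M_{red}\to\mathbb{R}$ be the function induced by $$\mu_1[z_0:z_1:z_2]=-\frac12\,\frac{|z_1|^2}{|z_0|^2+|z_1|^2+|z_2|^2}.$$ A one-to-one transverse lifting of a subset $\ell\subset M_{red}$ is a compact embedded lagrangian submanifold $L\subset\mathbb{CP}^2$ that intersects the level set $\mu_2^{-1}(-\tfrac16)$ transversally and meets each $S^1$-orbit in that level set at most once, with $\ell=\pi\bigl(L\cap\mu_2^{-1}(-\tfrac16)\bigr)$. Then $$\mathcal{L}_2=\bigl\{[X-iY:\sqrt2\,iZ:X+iY]\;\bigm|\;X,Y,Z\in\mathbb{R},\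 X^2+Y^2+Z^2=1\bigr\}\subset\mathbb{CP}^2$$ is a one-to-one transverse lifting of a great circle $\ell_2$ in $M_{red}\simeq\mathbb{CP}^1$, where a great circle of $\mathbb{CP}^1$ means the intersection of the round sphere $S^2\simeq\mathbb{CP}^1$ with a plane through the origin, under the map $[z_0:z_1]\mapsto\bigl(2\operatorname{Re}(z_0\bar z_1),\,2\operatorname{Im}(z_0\bar z_1),\,|z_0|^2-|z_1|^2\bigr)/(|z_0|^2+|z_1|^2)$. Moreover $\mu_{red}(M_{red})=[-\tfrac13,0]$, and $\ell_2$ is the middle level set $\mu_{red}^{-1}(-\tfrac16)$. -/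

import Mathlib

open Set Topology
open scoped Manifold ContDiff

namespace ChiangLagrangian

noncomputable section

/-! ### Submanifolds, transversality, and liftings from a reduced space -/

section General

variable {E : Type*} [NormedAddCommGroup E] [NormedSpace ℝ E]
  {M : Type*} [TopologicalSpace M] [ChartedSpace E M]

/-- `S` is an embedded smooth submanifold of codimension `c` of the manifold `M`: near each of its
points it is the zero set of a smooth map to `ℝᶜ` that is a submersion along `S`. -/
def IsSmoothSubmanifold (E : Type*) [NormedAddCommGroup E] [NormedSpace ℝ E]
    {M : Type*} [TopologicalSpace M] [ChartedSpace E M] (c : ℕ) (S : Set M) : Prop :=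
  ∀ p ∈ S, ∃ (U : Set M) (F : M → Fin c → ℝ), IsOpen U ∧ p ∈ U ∧
    ContMDiffOn 𝓘(ℝ, E) 𝓘(ℝ, Fin c → ℝ) ∞ F U ∧
    (∀ q ∈ S ∩ U, Function.Surjective (mfderiv 𝓘(ℝ, E) 𝓘(ℝ, Fin c → ℝ) F q)) ∧
    S ∩ U = {q ∈ U | F q = 0}

/-- The tangent space at `p` of a submanifold `S` of `M`, as a subset of `T_p M`: all velocities
at `p` of smooth curves that run in `S`. -/
def tangentVectors (E : Type*) [NormedAddCommGroup E] [NormedSpace ℝ E]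
    {M : Type*} [TopologicalSpace M] [ChartedSpace E M] (S : Set M) (p : M) :
    Set (TangentSpace 𝓘(ℝ, E) p) :=
  {v | ∃ γ : ℝ → M, ContMDiff 𝓘(ℝ, ℝ) 𝓘(ℝ, E) ∞ γ ∧ (∀ t, γ t ∈ S) ∧
    ∃ h : γ 0 = p, h ▸ (mfderiv 𝓘(ℝ, ℝ) 𝓘(ℝ, E) γ 0 (1 : ℝ) : TangentSpace 𝓘(ℝ, E) (γ 0)) = v}

/-- `S` and `S'` are embedded submanifolds (of codimensions `c` and `c'`) that intersect
transversally: `T_p S + T_p S' = T_p M` at every common point `p`. -/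
def IntersectTransversally (E : Type*) [NormedAddCommGroup E] [NormedSpace ℝ E]
    {M : Type*} [TopologicalSpace M] [ChartedSpace E M] (c c' : ℕ) (S S' : Set M) : Prop :=
  IsSmoothSubmanifold E c S ∧ IsSmoothSubmanifold E c' S' ∧
    ∀ p ∈ S ∩ S', ∀ v : TangentSpace 𝓘(ℝ, E) p,
      ∃ u ∈ tangentVectors E S p, ∃ w ∈ tangentVectors E S' p, u + w = v

/-- `L` is a lagrangian submanifold for the 2-form `Ω`: an embedded submanifold of half the
dimension of `M` on whose tangent spaces `Ω` vanishes. -/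
def IsLagrangian (Ω : ∀ p : M, LinearMap.BilinForm ℝ (TangentSpace 𝓘(ℝ, E) p)) (L : Set M) :
    Prop :=
  (∃ c : ℕ, Module.finrank ℝ E = 2 * c ∧ IsSmoothSubmanifold E c L) ∧
    ∀ p ∈ L, ∀ u ∈ tangentVectors E L p, ∀ v ∈ tangentVectors E L p, Ω p u v = 0

/-- Two points of the level set `μ⁻¹(a)` are equivalent when they lie on one orbit of `G`. -/
def levelSetoid (G : Type*) [Group G] {M V : Type*} [MulAction G M] (μ : M → V) (a : V) :
    Setoid (μ ⁻¹' {a}) :=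
  (MulAction.orbitRel G M).comap Subtype.val

/-- The reduced space `μ⁻¹(a) / G`. -/
def ReducedSpace (G : Type*) [Group G] {M V : Type*} [MulAction G M] (μ : M → V) (a : V) : Type _ :=
  Quotient (levelSetoid G μ a)

/-- The point-orbit projection `π : μ⁻¹(a) → μ⁻¹(a) / G`. -/
def orbitProj (G : Type*) [Group G] {M V : Type*} [MulAction G M] (μ : M → V) (a : V) :
    μ ⁻¹' {a} → ReducedSpace G μ a :=
  Quotient.mk (levelSetoid G μ a)

/-- The quotient topology of the reduced space. -/
instance (G : Type*) [Group G] {M V : Type*} [TopologicalSpace M] [MulAction G M]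
    (μ : M → V) (a : V) : TopologicalSpace (ReducedSpace G μ a) :=
  inferInstanceAs (TopologicalSpace (Quotient (levelSetoid G μ a)))

/-- `L ⊆ M` is a one-to-one transverse lifting of the subset `ℓ` of the reduced space
`μ⁻¹(a) / G`: it is a compact lagrangian submanifold, it intersects the level set `μ⁻¹(a)`
transversally, it meets each orbit in the level set at most once, and `ℓ = π (L ∩ μ⁻¹(a))`. -/
structure IsOneToOneTransverseLifting {G : Type*} [Group G] [MulAction G M]
    {V : Type*} [AddCommGroup V] [Module ℝ V]
    (Ω : ∀ p : M, LinearMap.BilinForm ℝ (TangentSpace 𝓘(ℝ, E) p)) (μ : M → V) (a : V)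
    (L : Set M) (ℓ : Set (ReducedSpace G μ a)) : Prop where
  isCompact : IsCompact L
  isLagrangian : IsLagrangian Ω L
  transverse : IntersectTransversally E (Module.finrank ℝ E / 2) (Module.finrank ℝ V) L (μ ⁻¹' {a})
  injOn : InjOn (orbitProj G μ a) {x | (x : M) ∈ L}
  eq_image : ℓ = orbitProj G μ a '' {x | (x : M) ∈ L}

end General

/-! ### Complex projective space -/

/-- Complex projective `n`-space: the nonzero vectors of `ℂⁿ⁺¹` up to nonzero complex scalars. -/
def CP (n : ℕ) : Type := Projectivization ℂ (Fin (n + 1) → ℂ)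

namespace CP

variable {n : ℕ}

/-- The point `[v 0 : … : v n]`. -/
def mk (v : Fin (n + 1) → ℂ) (hv : v ≠ 0) : CP n := Projectivization.mk ℂ v hv

/-- Maps out of `CP n` are scaling invariant maps of homogeneous coordinates. -/
def lift {α : Type*} (f : (Fin (n + 1) → ℂ) → α)
    (hf : ∀ (v : Fin (n + 1) → ℂ) (t : ℂ), v ≠ 0 → t ≠ 0 → f (t • v) = f v) (p : CP n) : α :=
  Projectivization.lift (fun v => f v.1) (by
    rintro ⟨a, ha⟩ ⟨b, hb⟩ t h
    simp only at h ⊢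
    rw [h]
    refine hf b t hb ?_
    rintro rfl
    exact ha (by rw [h, zero_smul])) p

@[simp] theorem lift_mk {α : Type*} (f : (Fin (n + 1) → ℂ) → α)
    (hf : ∀ (v : Fin (n + 1) → ℂ) (t : ℂ), v ≠ 0 → t ≠ 0 → f (t • v) = f v)
    (v : Fin (n + 1) → ℂ) (hv : v ≠ 0) : lift f hf (mk v hv) = f v := rfl

@[elab_as_elim]
theorem ind {P : CP n → Prop} (h : ∀ v hv, P (mk v hv)) (p : CP n) : P p :=
  Projectivization.ind h p

theorem mk_eq_mk_iff (v w : Fin (n + 1) → ℂ) (hv : v ≠ 0) (hw : w ≠ 0) :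
    mk v hv = mk w hw ↔ ∃ t : ℂ, t • w = v :=
  Projectivization.mk_eq_mk_iff' ℂ v w hv hw

/-- The quotient topology. -/
instance : TopologicalSpace (CP n) :=
  inferInstanceAs (TopologicalSpace (Quotient (projectivizationSetoid ℂ (Fin (n + 1) → ℂ))))

theorem isQuotientMap_mk :
    IsQuotientMap (fun v : {v : Fin (n + 1) → ℂ // v ≠ 0} => (mk v.1 v.2 : CP n)) :=
  isQuotientMap_quot_mk

theorem continuous_mk :
    Continuous (fun v : {v : Fin (n + 1) → ℂ // v ≠ 0} => (mk v.1 v.2 : CP n)) :=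
  isQuotientMap_mk.continuous

/-- The affine domain `z_j ≠ 0`. -/
def affineDomain (j : Fin (n + 1)) : Set (CP n) :=
  {p | lift (fun v => v j ≠ 0) (by intro v t _ ht; simp [ht]) p}

theorem mk_mem_affineDomain (j : Fin (n + 1)) (v : Fin (n + 1) → ℂ) (hv : v ≠ 0) :
    mk v hv ∈ affineDomain j ↔ v j ≠ 0 := Iff.rfl

theorem isOpen_affineDomain (j : Fin (n + 1)) : IsOpen (affineDomain j : Set (CP n)) := by
  rw [← isQuotientMap_mk.isOpen_preimage]
  have : Continuous fun v : {v : Fin (n + 1) → ℂ // v ≠ 0} => v.1 j :=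
    (continuous_apply j).comp continuous_subtype_val
  exact isOpen_ne.preimage this

/-- The affine coordinates `z_i / z_j`, `i ≠ j`. -/
def affineCoord (j : Fin (n + 1)) : CP n → Fin n → ℂ :=
  lift (fun v i => v (j.succAbove i) / v j) (by
    intro v t _ ht
    funext i
    simp [mul_div_mul_left _ _ ht])

theorem insertNth_one_ne_zero (j : Fin (n + 1)) (w : Fin n → ℂ) :
    (j.insertNth (α := fun _ => ℂ) 1 w) ≠ 0 := by
  intro h
  have := congrFun h j
  simp at this

theorem continuous_insertNth_one (j : Fin (n + 1)) :
    Continuous fun w : Fin n → ℂ => (j.insertNth (α := fun _ => ℂ) 1 w) :=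
  continuous_const.finInsertNth j continuous_id

/-- The affine chart `[z] ↦ (z_i / z_j)_{i ≠ j}` on the domain `z_j ≠ 0`, with inverse
`w ↦ [w_0 : … : 1 : … : w_{n-1}]`. -/
def affineChart (j : Fin (n + 1)) : OpenPartialHomeomorph (CP n) (Fin n → ℂ) where
  toFun := affineCoord j
  invFun w := mk (j.insertNth (α := fun _ => ℂ) 1 w) (insertNth_one_ne_zero j w)
  source := affineDomain j
  target := univ
  map_source' _ _ := mem_univ _
  map_target' w _ := by
    rw [mk_mem_affineDomain]
    simp
  left_inv' p := by
    induction p using ind with | h v hv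
    intro h
    rw [mk_mem_affineDomain] at h
    rw [mk_eq_mk_iff]
    refine ⟨(v j)⁻¹, ?_⟩
    funext i
    refine Fin.succAboveCases j ?_ (fun i => ?_) i
    · simp [h]
    · simp [affineCoord, div_eq_inv_mul]
  right_inv' w _ := by
    funext i
    simp [affineCoord]
  open_source := isOpen_affineDomain j
  open_target := isOpen_univ
  continuousOn_toFun := by
    rw [continuousOn_iff_continuous_domRestrict]
    have hq := isQuotientMap_mk (n := n) |>.restrictPreimage_isOpen (isOpen_affineDomain j)
    rw [hq.continuous_iff]
    refine continuous_pi fun i => ?_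
    have hc : ∀ k : Fin (n + 1), Continuous fun v : ((fun v : {v : Fin (n + 1) → ℂ // v ≠ 0} =>
        (mk v.1 v.2 : CP n)) ⁻¹' affineDomain j) => v.1.1 k := fun k =>
      (continuous_apply k).comp (continuous_subtype_val.comp continuous_subtype_val)
    exact (hc (j.succAbove i)).div (hc j) (fun v => v.2)
  continuousOn_invFun :=
    (continuous_mk.comp ((continuous_insertNth_one j).subtype_mk
      (insertNth_one_ne_zero j))).continuousOn

theorem exists_mem_affineDomain (p : CP n) : ∃ j, p ∈ affineDomain j := by
  induction p using ind with | h v hv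
  exact Function.ne_iff.mp hv

/-- An index of a nonvanishing homogeneous coordinate of `p`. -/
def chartIndex (p : CP n) : Fin (n + 1) := (exists_mem_affineDomain p).choose

theorem mem_affineDomain_chartIndex (p : CP n) : p ∈ affineDomain (chartIndex p) :=
  (exists_mem_affineDomain p).choose_spec

/-- The standard atlas of affine charts. -/
instance : ChartedSpace (Fin n → ℂ) (CP n) where
  atlas := range affineChart
  chartAt p := affineChart (chartIndex p)
  mem_chart_source := mem_affineDomain_chartIndex
  chart_mem_atlas _ := mem_range_self _

/-- `CP n` is a smooth real manifold, of real dimension `2 n`. -/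
instance : IsManifold 𝓘(ℝ, Fin n → ℂ) ∞ (CP n) := by
  refine isManifold_of_contDiffOn _ _ _ ?_
  rintro _ _ ⟨j, rfl⟩ ⟨k, rfl⟩
  simp only [modelWithCornersSelf_coe, modelWithCornersSelf_coe_symm, Function.comp_id,
    Function.id_comp, preimage_id_eq, id_eq, range_id, inter_univ]
  have hs : ∀ i : Fin (n + 1), ContDiff ℝ ∞ fun w : Fin n → ℂ =>
      (j.insertNth (α := fun _ => ℂ) 1 w) i := by
    intro i
    refine Fin.succAboveCases j ?_ (fun i => ?_) i
    · simpa using contDiff_const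
    · simpa using contDiff_apply ℝ ℂ i
  rw [contDiffOn_pi]
  intro i
  have : ContDiffOn ℝ ∞ (fun w : Fin n → ℂ =>
      (j.insertNth (α := fun _ => ℂ) 1 w) (k.succAbove i) *
        ((j.insertNth (α := fun _ => ℂ) 1 w) k)⁻¹)
      ((affineChart j).symm.trans (affineChart k)).source := by
    refine (hs _).contDiffOn.mul ((hs k).contDiffOn.inv ?_)
    intro w hw
    exact hw.2
  exact this.congr fun w _ => div_eq_mul_inv _ _

end CP

/-! ### The Fubini–Study form and the toric moment maps -/

/-- The Fubini–Study form in homogeneous coordinates, at `z ∈ ℂⁿ⁺¹ ∖ {0}`: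
`Im (h(V, W) / |z|² - h(V, z) h(z, W) / |z|⁴)` with `h(V, W) = ∑ conj (V_k) W_k`.  On the unit
sphere, for vectors orthogonal to `z`, it is the standard form
`(i/2) ∑ dz_k ∧ d(conj z_k)`, so that `CPⁿ` has symplectic volume `πⁿ / n!`. -/
def homogeneousForm {n : ℕ} (z V W : Fin (n + 1) → ℂ) : ℝ :=
  ((star V ⬝ᵥ W) / (star z ⬝ᵥ z) - (star V ⬝ᵥ z) * (star z ⬝ᵥ W) / (star z ⬝ᵥ z) ^ 2).im

open scoped ComplexOrder in
/-- `homogeneousForm` descends to projective space: it is invariant under the changes of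
`(z, V, W)` that do not change the point `[z]` and the tangent vectors at `[z]` that `V` and `W`
represent. -/
theorem homogeneousForm_descends {n : ℕ} (z V W : Fin (n + 1) → ℂ) (hz : z ≠ 0) (t a b : ℂ)
    (ht : t ≠ 0) :
    homogeneousForm (t • z) (t • V + a • z) (t • W + b • z) = homogeneousForm z V W := by
  have hz' : star z ⬝ᵥ z ≠ 0 := by
    rwa [Ne, dotProduct_star_self_eq_zero]
  have hs : star t ≠ 0 := by simpa using ht
  unfold homogeneousForm
  congr 1
  simp only [star_add, star_smul, add_dotProduct, dotProduct_add, smul_dotProduct,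
    dotProduct_smul, smul_eq_mul]
  field_simp
  ring

theorem homogeneousForm_add_left {n : ℕ} (z V V' W : Fin (n + 1) → ℂ) :
    homogeneousForm z (V + V') W = homogeneousForm z V W + homogeneousForm z V' W := by
  unfold homogeneousForm
  rw [← Complex.add_im]
  congr 1
  simp only [star_add, add_dotProduct]
  ring

theorem homogeneousForm_add_right {n : ℕ} (z V W W' : Fin (n + 1) → ℂ) :
    homogeneousForm z V (W + W') = homogeneousForm z V W + homogeneousForm z V W' := by
  unfold homogeneousForm
  rw [← Complex.add_im]
  congr 1
  simp only [dotProduct_add]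
  ring

theorem homogeneousForm_smul_left {n : ℕ} (c : ℝ) (z V W : Fin (n + 1) → ℂ) :
    homogeneousForm z (c • V) W = c * homogeneousForm z V W := by
  unfold homogeneousForm
  rw [← Complex.im_ofReal_mul]
  congr 1
  simp only [star_smul, star_trivial, smul_dotProduct, Complex.real_smul]
  ring

theorem homogeneousForm_smul_right {n : ℕ} (c : ℝ) (z V W : Fin (n + 1) → ℂ) :
    homogeneousForm z V (c • W) = c * homogeneousForm z V W := by
  unfold homogeneousForm
  rw [← Complex.im_ofReal_mul]
  congr 1
  simp only [dotProduct_smul, Complex.real_smul]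
  ring

theorem insertNth_zero_add {n : ℕ} (j : Fin (n + 1)) (u v : Fin n → ℂ) :
    j.insertNth (α := fun _ => ℂ) 0 (u + v) =
      j.insertNth (α := fun _ => ℂ) 0 u + j.insertNth (α := fun _ => ℂ) 0 v := by
  funext i
  refine Fin.succAboveCases j ?_ (fun i => ?_) i <;> simp

theorem insertNth_zero_smul {n : ℕ} (j : Fin (n + 1)) (c : ℝ) (u : Fin n → ℂ) :
    j.insertNth (α := fun _ => ℂ) 0 (c • u) = c • j.insertNth (α := fun _ => ℂ) 0 u := by
  funext i
  refine Fin.succAboveCases j ?_ (fun i => ?_) i <;> simp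

/-- The Fubini–Study form in the `j`-th affine chart, at the point with affine coordinates `w`.
The inverse of the chart lifts to `w ↦ (w_0, …, 1, …, w_{n-1})`, whose derivative is
`u ↦ (u_0, …, 0, …, u_{n-1})`. -/
def affineForm {n : ℕ} (j : Fin (n + 1)) (w : Fin n → ℂ) : LinearMap.BilinForm ℝ (Fin n → ℂ) :=
  LinearMap.mk₂ ℝ (fun u v => homogeneousForm (j.insertNth (α := fun _ => ℂ) 1 w)
      (j.insertNth (α := fun _ => ℂ) 0 u) (j.insertNth (α := fun _ => ℂ) 0 v))
    (fun _ _ _ => by rw [insertNth_zero_add, homogeneousForm_add_left])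
    (fun _ _ _ => by rw [insertNth_zero_smul, homogeneousForm_smul_left]; rfl)
    (fun _ _ _ => by rw [insertNth_zero_add, homogeneousForm_add_right])
    (fun _ _ _ => by rw [insertNth_zero_smul, homogeneousForm_smul_right]; rfl)

/-- The Fubini–Study symplectic form on `CP n`.  The tangent space at `p` is read in the preferred
affine chart at `p`, that is, in `chartAt (Fin n → ℂ) p`. -/
def fubiniStudy (n : ℕ) (p : CP n) : LinearMap.BilinForm ℝ (TangentSpace 𝓘(ℝ, Fin n → ℂ) p) :=
  affineForm p.chartIndex (CP.affineChart p.chartIndex p)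

/-- The moment map `-(1/2) |z_j|² / ∑ |z_k|²` of the rotation of the `j`-th coordinate. -/
def moment {n : ℕ} (j : Fin (n + 1)) : CP n → ℝ :=
  CP.lift (fun z => -(1 / 2) * (‖z j‖ ^ 2 / ∑ k, ‖z k‖ ^ 2)) (by
    intro v t _ ht
    have : ‖t‖ ^ 2 ≠ 0 := by simpa using ht
    simp [mul_pow, ← Finset.mul_sum, mul_div_mul_left _ _ this])

/-! ### The second circle action on `CP 2` and its reduction at level `-1/6` -/

/-- `(z_0, z_1, z_2) ↦ (z_0, z_1, g z_2)`. -/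
def rotateLinear (g : Circle) : (Fin 3 → ℂ) →ₗ[ℂ] (Fin 3 → ℂ) where
  toFun v := ![v 0, v 1, g * v 2]
  map_add' v w := by
    funext i
    fin_cases i <;> simp [mul_add]
  map_smul' c v := by
    funext i
    fin_cases i <;> simp [mul_left_comm]

theorem rotateLinear_injective (g : Circle) : Function.Injective (rotateLinear g) := by
  intro v w h
  have h0 := congrFun h 0
  have h1 := congrFun h 1
  have h2 := congrFun h 2
  simp [rotateLinear] at h0 h1 h2
  funext i
  fin_cases i <;> assumption

theorem rotateLinear_ne_zero (g : Circle) {v : Fin 3 → ℂ} (hv : v ≠ 0) : rotateLinear g v ≠ 0 :=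
  fun h => hv (rotateLinear_injective g (by rw [h, map_zero]))

/-- The second circle action: `g • [z_0 : z_1 : z_2] = [z_0 : z_1 : g z_2]`. -/
instance : MulAction Circle (CP 2) where
  smul g p := Projectivization.map (rotateLinear g) (rotateLinear_injective g) p
  one_smul p := by
    induction p using CP.ind with | h v hv
    change CP.mk (rotateLinear 1 v) (rotateLinear_ne_zero 1 hv) = _
    congr 1
    funext i
    fin_cases i <;> simp [rotateLinear]
  mul_smul g g' p := by
    induction p using CP.ind with | h v hv
    change CP.mk (rotateLinear (g * g') v) (rotateLinear_ne_zero _ hv) =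
      CP.mk (rotateLinear g (rotateLinear g' v))
        (rotateLinear_ne_zero _ (rotateLinear_ne_zero _ hv))
    congr 1
    funext i
    fin_cases i <;> simp [rotateLinear, mul_assoc]

theorem smul_mk (g : Circle) (v : Fin 3 → ℂ) (hv : v ≠ 0) :
    g • CP.mk v hv = CP.mk (rotateLinear g v) (rotateLinear_ne_zero g hv) := rfl

/-- The moment map `μ₂ [z] = -(1/2) |z_2|² / |z|²` of the second circle action on `CP 2`. -/
abbrev mu2 : CP 2 → ℝ := moment 2

/-- The reduced space `μ₂⁻¹(-1/6) / S¹`. -/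
abbrev Reduced : Type := ReducedSpace Circle mu2 (-1 / 6)

theorem moment_one_smul (g : Circle) (p : CP 2) : moment 1 (g • p) = moment 1 p := by
  induction p using CP.ind with | h v hv
  have h0 : ∀ w : Fin 3 → ℂ, ∑ k : Fin (2 + 1), ‖w k‖ ^ 2 = ‖w 0‖ ^ 2 + ‖w 1‖ ^ 2 + ‖w 2‖ ^ 2 :=
    fun w => Fin.sum_univ_three _
  simp only [smul_mk, moment, CP.lift_mk]
  rw [h0, h0]
  simp [rotateLinear, Circle.norm_coe]

/-- The moment map `μ_red` on the reduced space that is induced by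
`μ₁ [z] = -(1/2) |z_1|² / |z|²`. -/
def muRed : Reduced → ℝ :=
  Quotient.lift (fun x => moment 1 x.1) (by
    rintro x y ⟨g, hg⟩
    change g • y.1 = x.1 at hg
    rw [← hg, moment_one_smul])

theorem level_iff (v : Fin 3 → ℂ) (hv : v ≠ 0) :
    CP.mk v hv ∈ mu2 ⁻¹' {-1 / 6} ↔ ‖v 0‖ ^ 2 + ‖v 1‖ ^ 2 = 2 * ‖v 2‖ ^ 2 := by
  have hpos : 0 < ‖v 0‖ ^ 2 + ‖v 1‖ ^ 2 + ‖v 2‖ ^ 2 := by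
    by_contra! h
    apply hv
    have h0 : ‖v 0‖ = 0 := by nlinarith [sq_nonneg ‖v 0‖, sq_nonneg ‖v 1‖, sq_nonneg ‖v 2‖]
    have h1 : ‖v 1‖ = 0 := by nlinarith [sq_nonneg ‖v 0‖, sq_nonneg ‖v 1‖, sq_nonneg ‖v 2‖]
    have h2 : ‖v 2‖ = 0 := by nlinarith [sq_nonneg ‖v 0‖, sq_nonneg ‖v 1‖, sq_nonneg ‖v 2‖]
    rw [norm_eq_zero] at h0 h1 h2
    funext i
    fin_cases i <;> assumption
  have h0 : ∑ k : Fin (2 + 1), ‖v k‖ ^ 2 = ‖v 0‖ ^ 2 + ‖v 1‖ ^ 2 + ‖v 2‖ ^ 2 :=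
    Fin.sum_univ_three _
  simp only [mem_preimage, mem_singleton_iff, moment, CP.lift_mk]
  rw [h0]
  field_simp
  constructor <;> intro h <;> linarith

/-- The projection `[z_0 : z_1 : z_2] ↦ [z_0 : z_1]`, with the value `[1 : 0]` at `[0 : 0 : 1]`,
where it is not defined. -/
def forgetLast : CP 2 → CP 1 :=
  CP.lift (fun v => if h : ![v 0, v 1] ≠ 0 then CP.mk ![v 0, v 1] h else
    CP.mk ![1, 0] (by simp)) (by
    intro v t _ ht
    by_cases h : ![v 0, v 1] = 0
    · have h' : ![(t • v) 0, (t • v) 1] = 0 := by simp_all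
      simp only [ne_eq, h, h', not_true_eq_false, dite_false]
    · have h' : ![(t • v) 0, (t • v) 1] ≠ 0 := by simpa [ht] using h
      rw [dif_pos h', dif_pos h, CP.mk_eq_mk_iff]
      exact ⟨t, by simp⟩)

theorem head_ne_zero_of_level (v : Fin 3 → ℂ) (hv : v ≠ 0)
    (h : CP.mk v hv ∈ mu2 ⁻¹' {-1 / 6}) : ![v 0, v 1] ≠ 0 := by
  intro h'
  have h0 : v 0 = 0 := congrFun h' 0
  have h1 : v 1 = 0 := congrFun h' 1
  rw [level_iff] at h
  have h2 : v 2 = 0 := by simpa [h0, h1] using h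
  apply hv
  funext i
  fin_cases i <;> assumption

theorem forgetLast_mk (v : Fin 3 → ℂ) (hv : v ≠ 0) (h : ![v 0, v 1] ≠ 0) :
    forgetLast (CP.mk v hv) = CP.mk ![v 0, v 1] h := by
  simp only [forgetLast, CP.lift_mk]
  rw [dif_pos h]

theorem mk_mem_forgetDomain (v : Fin 3 → ℂ) (hv : v ≠ 0) (h : ![v 0, v 1] ≠ 0) :
    CP.mk v hv ∈ (CP.affineDomain 0 ∪ CP.affineDomain 1 : Set (CP 2)) := by
  by_contra h'
  simp only [mem_union, CP.mk_mem_affineDomain, not_or, not_not] at h'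
  exact h (by simp [h'.1, h'.2])

theorem head_ne_zero_of_mem (v : Fin 3 → ℂ) (hv : v ≠ 0)
    (h : CP.mk v hv ∈ (CP.affineDomain 0 ∪ CP.affineDomain 1 : Set (CP 2))) :
    ![v 0, v 1] ≠ 0 := by
  intro h'
  rcases h with h | h
  · exact h (congrFun h' 0)
  · exact h (congrFun h' 1)

theorem continuousOn_forgetLast :
    ContinuousOn forgetLast (CP.affineDomain 0 ∪ CP.affineDomain 1) := by
  rw [continuousOn_iff_continuous_domRestrict]
  have hq := (CP.isQuotientMap_mk (n := 2)).restrictPreimage_isOpen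
    ((CP.isOpen_affineDomain 0).union (CP.isOpen_affineDomain 1))
  rw [hq.continuous_iff]
  have hc : ∀ k : Fin 3, Continuous fun v : ((fun v : {v : Fin 3 → ℂ // v ≠ 0} =>
      (CP.mk v.1 v.2 : CP 2)) ⁻¹' (CP.affineDomain 0 ∪ CP.affineDomain 1)) => v.1.1 k := fun k =>
    (continuous_apply k).comp (continuous_subtype_val.comp continuous_subtype_val)
  have hc' : Continuous fun v : ((fun v : {v : Fin 3 → ℂ // v ≠ 0} =>
      (CP.mk v.1 v.2 : CP 2)) ⁻¹' (CP.affineDomain 0 ∪ CP.affineDomain 1)) =>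
      ![v.1.1 0, v.1.1 1] := by
    refine continuous_pi fun i => ?_
    fin_cases i
    · exact hc 0
    · exact hc 1
  convert CP.continuous_mk.comp (hc'.subtype_mk fun v =>
    head_ne_zero_of_mem v.1.1 v.1.2 v.2) using 1
  funext v
  exact forgetLast_mk v.1.1 v.1.2 (head_ne_zero_of_mem v.1.1 v.1.2 v.2)

/-- The lift `(w_0, w_1) ↦ (w_0, w_1, ((|w_0|² + |w_1|²) / 2)^{1/2})` to the level set. -/
def levelVec (w : Fin 2 → ℂ) : Fin 3 → ℂ :=
  ![w 0, w 1, (Real.sqrt ((‖w 0‖ ^ 2 + ‖w 1‖ ^ 2) / 2) : ℝ)]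

theorem levelVec_ne_zero {w : Fin 2 → ℂ} (hw : w ≠ 0) : levelVec w ≠ 0 := by
  intro h
  apply hw
  have h0 : w 0 = 0 := congrFun h 0
  have h1 : w 1 = 0 := congrFun h 1
  funext i
  fin_cases i <;> assumption

theorem levelVec_mem {w : Fin 2 → ℂ} (hw : w ≠ 0) :
    CP.mk (levelVec w) (levelVec_ne_zero hw) ∈ mu2 ⁻¹' {-1 / 6} := by
  rw [level_iff]
  have : 0 ≤ (‖w 0‖ ^ 2 + ‖w 1‖ ^ 2) / 2 := by positivity
  have h2 : ‖levelVec w 2‖ ^ 2 = (‖w 0‖ ^ 2 + ‖w 1‖ ^ 2) / 2 := by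
    change ‖((Real.sqrt ((‖w 0‖ ^ 2 + ‖w 1‖ ^ 2) / 2) : ℝ) : ℂ)‖ ^ 2 = _
    rw [Complex.norm_real, Real.norm_eq_abs, sq_abs, Real.sq_sqrt this]
  rw [h2]
  change ‖w 0‖ ^ 2 + ‖w 1‖ ^ 2 = _
  ring

/-- Points of the level set with the same image in `CP 1` lie on one circle orbit. -/
theorem exists_rotate {v w : Fin 3 → ℂ} (hv : v ≠ 0) (hw : w ≠ 0)
    (hvl : CP.mk v hv ∈ mu2 ⁻¹' {-1 / 6}) (hwl : CP.mk w hw ∈ mu2 ⁻¹' {-1 / 6})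
    (t : ℂ) (ht : t ≠ 0) (h0 : v 0 = t * w 0) (h1 : v 1 = t * w 1) :
    ∃ g : Circle, g • CP.mk w hw = CP.mk v hv := by
  have hw2 : w 2 ≠ 0 := by
    intro h
    rw [level_iff, h] at hwl
    have hh := head_ne_zero_of_level w hw (by rw [level_iff, h]; exact hwl)
    apply hh
    have a0 : ‖w 0‖ = 0 := by
      simp at hwl
      nlinarith [sq_nonneg ‖w 0‖, sq_nonneg ‖w 1‖]
    have a1 : ‖w 1‖ = 0 := by
      simp at hwl
      nlinarith [sq_nonneg ‖w 0‖, sq_nonneg ‖w 1‖]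
    rw [norm_eq_zero] at a0 a1
    simp [a0, a1]
  rw [level_iff] at hvl hwl
  have hn : ‖v 2‖ = ‖t * w 2‖ := by
    rw [h0, h1, norm_mul, norm_mul, mul_pow, mul_pow, ← mul_add, hwl] at hvl
    rw [← sq_eq_sq₀ (norm_nonneg _) (norm_nonneg _), norm_mul, mul_pow]
    linarith
  have htw : t * w 2 ≠ 0 := mul_ne_zero ht hw2
  have hg : v 2 / (t * w 2) ∈ Submonoid.unitSphere ℂ := by
    change _ ∈ Metric.sphere (0 : ℂ) 1
    rw [mem_sphere_zero_iff_norm, norm_div, hn, div_self (norm_ne_zero_iff.mpr htw)]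
  let g : Circle := ⟨v 2 / (t * w 2), hg⟩
  have hgc : (g : ℂ) = v 2 / (t * w 2) := rfl
  refine ⟨g, ?_⟩
  rw [smul_mk, CP.mk_eq_mk_iff]
  refine ⟨t⁻¹, ?_⟩
  funext i
  fin_cases i
  · simp [rotateLinear, h0, ht]
  · simp [rotateLinear, h1, ht]
  · simp [rotateLinear, hgc]
    field_simp

/-- The identification of the reduced space with `CP 1`: the orbit of `[z_0 : z_1 : z_2]` in the
level set corresponds to `[z_0 : z_1]`. -/
def reducedHomeomorph : Reduced ≃ₜ CP 1 where
  toFun := Quotient.lift (fun x => forgetLast x.1) (by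
    rintro ⟨p, hp⟩ ⟨q, hq⟩ ⟨g, hg⟩
    change g • q = p at hg
    change forgetLast p = forgetLast q
    subst hg
    induction q using CP.ind with | h v hv
    rw [smul_mk]
    rfl)
  invFun := CP.lift (fun w => if hw : w ≠ 0 then
      orbitProj Circle mu2 (-1 / 6) ⟨CP.mk (levelVec w) (levelVec_ne_zero hw), levelVec_mem hw⟩
      else orbitProj Circle mu2 (-1 / 6) ⟨CP.mk (levelVec 1) (levelVec_ne_zero one_ne_zero),
        levelVec_mem one_ne_zero⟩) (by
    intro w t hw ht
    have hw' : t • w ≠ 0 := smul_ne_zero ht hw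
    rw [dif_pos hw, dif_pos hw']
    apply Quotient.sound
    obtain ⟨g, hg⟩ := exists_rotate (levelVec_ne_zero hw') (levelVec_ne_zero hw)
      (levelVec_mem hw') (levelVec_mem hw) t ht rfl rfl
    exact ⟨g, hg⟩)
  left_inv := by
    rintro ⟨⟨p, hp⟩⟩
    induction p using CP.ind with | h v hv
    have h := head_ne_zero_of_level v hv hp
    change CP.lift _ _ (forgetLast (CP.mk v hv)) = _
    rw [forgetLast_mk v hv h, CP.lift_mk, dif_pos h]
    apply Quotient.sound
    obtain ⟨g, hg⟩ := exists_rotate (levelVec_ne_zero h) hv (levelVec_mem h) hp 1 one_ne_zero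
      (by simp [levelVec]) (by simp [levelVec])
    exact ⟨g, hg⟩
  right_inv := by
    intro p
    induction p using CP.ind with | h w hw
    rw [CP.lift_mk, dif_pos hw]
    change forgetLast (CP.mk (levelVec w) _) = _
    have : ![levelVec w 0, levelVec w 1] = w := by
      funext i
      fin_cases i <;> rfl
    rw [forgetLast_mk _ _ (by rwa [this])]
    congr 1
  continuous_toFun := by
    refine continuous_quot_lift _ (continuousOn_forgetLast.comp_continuous
      continuous_subtype_val ?_)
    rintro ⟨p, hp⟩
    induction p using CP.ind with | h v hv
    exact mk_mem_forgetDomain v hv (head_ne_zero_of_level v hv hp)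
  continuous_invFun := by
    rw [CP.isQuotientMap_mk.continuous_iff]
    have hl : Continuous fun w : {w : Fin 2 → ℂ // w ≠ 0} => levelVec w.1 := by
      have h0 : Continuous fun w : {w : Fin 2 → ℂ // w ≠ 0} => w.1 0 :=
        (continuous_apply 0).comp continuous_subtype_val
      have h1 : Continuous fun w : {w : Fin 2 → ℂ // w ≠ 0} => w.1 1 :=
        (continuous_apply 1).comp continuous_subtype_val
      refine continuous_pi fun i => ?_
      fin_cases i
      · exact h0
      · exact h1
      · exact Complex.continuous_ofReal.comp (Real.continuous_sqrt.comp
          (((h0.norm.pow 2).add (h1.norm.pow 2)).div_const 2))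
    have hc : Continuous fun w : {w : Fin 2 → ℂ // w ≠ 0} =>
        orbitProj Circle mu2 (-1 / 6)
          ⟨CP.mk (levelVec w.1) (levelVec_ne_zero w.2), levelVec_mem w.2⟩ :=
      continuous_quot_mk.comp ((CP.continuous_mk.comp
        (hl.subtype_mk fun w => levelVec_ne_zero w.2)).subtype_mk fun w => levelVec_mem w.2)
    convert hc using 1
    funext w
    simp only [Function.comp_apply, CP.lift_mk]
    rw [dif_pos w.2]

/-- The Hopf map `CP 1 → S² ⊆ ℝ³`,
`[z_0 : z_1] ↦ (2 Re (z_0 conj z_1), 2 Im (z_0 conj z_1), |z_0|² - |z_1|²) / (|z_0|² + |z_1|²)`,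
which identifies `CP 1` with its Fubini–Study metric with a round sphere, up to scale. -/
def hopf : CP 1 → EuclideanSpace ℝ (Fin 3) :=
  CP.lift (fun z => (‖z 0‖ ^ 2 + ‖z 1‖ ^ 2)⁻¹ • !₂[2 * (z 0 * star (z 1)).re,
    2 * (z 0 * star (z 1)).im, ‖z 0‖ ^ 2 - ‖z 1‖ ^ 2]) (by
    intro v t _ ht
    have hn : ‖t‖ ^ 2 ≠ 0 := by simpa using ht
    have hx : ((t • v) 0 * star ((t • v) 1)) = ((‖t‖ ^ 2 : ℝ) : ℂ) * (v 0 * star (v 1)) := by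
      have : t * star t = ((‖t‖ ^ 2 : ℝ) : ℂ) := by
        rw [Complex.ofReal_pow]
        exact Complex.mul_conj' t
      rw [← this]
      simp only [Pi.smul_apply, smul_eq_mul, star_mul']
      ring
    rw [hx]
    simp only [Pi.smul_apply, smul_eq_mul, norm_mul, mul_pow, Complex.re_ofReal_mul,
      Complex.im_ofReal_mul, ← mul_add, ← mul_sub, mul_inv]
    ext i
    fin_cases i <;> simp <;> field_simp)

/-- A great circle of `CP 1`: the points of the round sphere on a plane through the origin. -/
def IsGreatCircle (S : Set (CP 1)) : Prop :=
  ∃ n : EuclideanSpace ℝ (Fin 3), n ≠ 0 ∧ S = {p | inner ℝ n (hopf p) = 0}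

/-- The vector `(X - iY, √2 i Z, X + iY)`. -/
def lagrangianVec (X Y Z : ℝ) : Fin 3 → ℂ :=
  ![X - Complex.I * Y, (Real.sqrt 2 : ℝ) * Complex.I * Z, X + Complex.I * Y]

theorem lagrangianVec_ne_zero {X Y Z : ℝ} (h : X ^ 2 + Y ^ 2 + Z ^ 2 = 1) :
    lagrangianVec X Y Z ≠ 0 := by
  intro h'
  have h1 := congrFun h' 1
  have h2 := congrArg Complex.re (congrFun h' 2)
  have h3 := congrArg Complex.im (congrFun h' 2)
  simp [lagrangianVec] at h1 h2 h3
  simp [h1, h2, h3] at h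

/-- `{[X - iY : √2 i Z : X + iY] | X² + Y² + Z² = 1}`. -/
def lagrangianL2 : Set (CP 2) :=
  {p | ∃ (X Y Z : ℝ) (h : X ^ 2 + Y ^ 2 + Z ^ 2 = 1),
    p = CP.mk (lagrangianVec X Y Z) (lagrangianVec_ne_zero h)}

end

end ChiangLagrangian

open ChiangLagrangian

/-!
`lagrangianL2` consists of the points with real coordinates in a linear frame of `ℂ³` on whose real
vectors the Hermitian form is real.  It is therefore a copy of `ℝP²` on whose tangent spaces the
Fubini–Study form, the imaginary part of the Hermitian form, vanishes.

A level set of `moment j` prescribes the ratio of `|z_j|` to the norm of the remaining coordinates,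
so it contains every tangent direction `(0, W)` with `W` orthogonal to these coordinates:
transversality has to be checked only on one non-orthogonal direction of `lagrangianL2`, and
`(0, z₁, 0)` is one.

Where `z₁ ≠ 0`, `lagrangianL2` is given by `z₀ z̄₁ + z₁ z̄₂ = 0`.  This determines `z₂` from
`[z₀ : z₁]`, so each circle orbit is met at most once, and as it gives `|z₂| = |z₀|` the orbits in
the level set that are met are those with `|z₀| = |z₁|`.  In the same level set
`|z₀|² + |z₁|² = 2 |z₂|²`, so `muRed` is two thirds of `moment 1` on `CP 1`, which is an affine
function of the height on the sphere: its level sets are parallel circles, the middle one great.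
-/

namespace ChiangLagrangian

noncomputable section

section RegularLevelSets

variable {E : Type*} [NormedAddCommGroup E] [NormedSpace ℝ E]
  {M : Type*} [TopologicalSpace M] [ChartedSpace E M]

theorem isSmoothSubmanifold_preimage_singleton {f : M → ℝ} {a : ℝ}
    (hf : ContMDiff 𝓘(ℝ, E) 𝓘(ℝ, ℝ) ∞ f)
    (hreg : ∀ q ∈ f ⁻¹' {a},
      (mfderiv 𝓘(ℝ, E) 𝓘(ℝ, ℝ) f q : TangentSpace 𝓘(ℝ, E) q →L[ℝ] ℝ) ≠ 0) :
    IsSmoothSubmanifold E 1 (f ⁻¹' {a}) := by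
  have hshift : ContDiff ℝ ∞ fun (x : ℝ) (_ : Fin 1) => x - a := by fun_prop
  refine fun p _ => ⟨univ, fun q _ => f q - a, isOpen_univ, mem_univ p,
    (hshift.contMDiff.comp hf).contMDiffOn, ?_, ?_⟩
  · rintro q ⟨hq, -⟩ c
    obtain ⟨v, hv⟩ := LinearMap.surjective
      (ContinuousLinearMap.coe_injective.ne (hreg q hq)) (c 0)
    have hpi : HasFDerivAt (fun (x : ℝ) (_ : Fin 1) => x - a)
        (ContinuousLinearMap.pi fun _ => ContinuousLinearMap.id ℝ ℝ) (f q) :=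
      hasFDerivAt_pi.2 fun _ => (hasFDerivAt_id (f q)).sub_const a
    have hcomp := hpi.hasMFDerivAt.comp q (hf.mdifferentiableAt (by simp)).hasMFDerivAt
    refine ⟨v, (congrArg (fun A => A v) hcomp.mfderiv).trans ?_⟩
    funext i
    rw [Subsingleton.elim i 0]
    exact hv
  · ext q
    simp [funext_iff, sub_eq_zero]

end RegularLevelSets

namespace CP

variable {n : ℕ}

/-- The point `[v 0 : … : v n]`, as a total function of `v`, so that it can be differentiated.
Its value at `v = 0` is junk. -/
def ofVec (v : Fin (n + 1) → ℂ) : CP n :=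
  open Classical in if h : v ≠ 0 then mk v h else mk 1 one_ne_zero

theorem ofVec_of_ne_zero {v : Fin (n + 1) → ℂ} (hv : v ≠ 0) : ofVec v = mk v hv :=
  dif_pos hv

theorem exists_eq_ofVec (p : CP n) : ∃ v, v ≠ 0 ∧ ofVec v = p := by
  induction p using ind with | h v hv
  exact ⟨v, hv, ofVec_of_ne_zero hv⟩

theorem ofVec_eq_ofVec_iff {v w : Fin (n + 1) → ℂ} (hv : v ≠ 0) (hw : w ≠ 0) :
    ofVec v = ofVec w ↔ ∃ c : ℂ, c • w = v := by
  rw [ofVec_of_ne_zero hv, ofVec_of_ne_zero hw, mk_eq_mk_iff]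

theorem ofVec_smul {c : ℂ} (hc : c ≠ 0) {v : Fin (n + 1) → ℂ} (hv : v ≠ 0) :
    ofVec (c • v) = ofVec v :=
  (ofVec_eq_ofVec_iff (smul_ne_zero hc hv) hv).2 ⟨c, rfl⟩

theorem lift_ofVec {α : Type*} (f : (Fin (n + 1) → ℂ) → α)
    (hf : ∀ (v : Fin (n + 1) → ℂ) (t : ℂ), v ≠ 0 → t ≠ 0 → f (t • v) = f v)
    {v : Fin (n + 1) → ℂ} (hv : v ≠ 0) : lift f hf (ofVec v) = f v := by
  rw [ofVec_of_ne_zero hv, lift_mk]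

theorem ofVec_mem_affineDomain {v : Fin (n + 1) → ℂ} (hv : v ≠ 0) (j : Fin (n + 1)) :
    ofVec v ∈ affineDomain j ↔ v j ≠ 0 := by
  rw [ofVec_of_ne_zero hv, mk_mem_affineDomain]

theorem apply_chartIndex_ofVec_ne_zero {v : Fin (n + 1) → ℂ} (hv : v ≠ 0) :
    v (ofVec v).chartIndex ≠ 0 :=
  (ofVec_mem_affineDomain hv _).1 (mem_affineDomain_chartIndex _)

theorem affineChart_ofVec {v : Fin (n + 1) → ℂ} (hv : v ≠ 0) (j : Fin (n + 1)) :
    affineChart j (ofVec v) = fun i => v (j.succAbove i) / v j := by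
  rw [ofVec_of_ne_zero hv]
  rfl

theorem affineChart_comp_ofVec_eventuallyEq {v : Fin (n + 1) → ℂ} (hv : v ≠ 0)
    (j : Fin (n + 1)) :
    (fun w => affineChart j (ofVec w)) =ᶠ[𝓝 v] fun w i => w (j.succAbove i) / w j := by
  filter_upwards [isOpen_ne.mem_nhds hv] with w hw
  exact affineChart_ofVec hw j

theorem continuousAt_ofVec {v : Fin (n + 1) → ℂ} (hv : v ≠ 0) :
    ContinuousAt (ofVec : (Fin (n + 1) → ℂ) → CP n) v := by
  have hc : ContinuousOn (ofVec : (Fin (n + 1) → ℂ) → CP n) {v | v ≠ 0} := by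
    rw [continuousOn_iff_continuous_domRestrict]
    exact continuous_mk.congr fun v => (ofVec_of_ne_zero v.2).symm
  exact hc.continuousAt (isOpen_ne.mem_nhds hv)

theorem contDiffAt_affineQuotient {v : Fin (n + 1) → ℂ} {j : Fin (n + 1)} (hj : v j ≠ 0) :
    ContDiffAt ℝ ∞ (fun (w : Fin (n + 1) → ℂ) (i : Fin n) => w (j.succAbove i) / w j) v := by
  rw [contDiffAt_pi]
  intro i
  simp only [div_eq_mul_inv]
  exact (contDiff_apply ℝ ℂ _).contDiffAt.mul ((contDiff_apply ℝ ℂ j).contDiffAt.inv hj)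

theorem contMDiffAt_ofVec {v : Fin (n + 1) → ℂ} (hv : v ≠ 0) :
    ContMDiffAt 𝓘(ℝ, Fin (n + 1) → ℂ) 𝓘(ℝ, Fin n → ℂ) ∞ (ofVec : (Fin (n + 1) → ℂ) → CP n) v := by
  rw [contMDiffAt_iff]
  refine ⟨continuousAt_ofVec hv, ?_⟩
  simp only [mfld_simps, contDiffWithinAt_univ]
  exact (contDiffAt_affineQuotient (apply_chartIndex_ofVec_ne_zero hv)).congr_of_eventuallyEq
    (affineChart_comp_ofVec_eventuallyEq hv _)

theorem mdifferentiableAt_ofVec {v : Fin (n + 1) → ℂ} (hv : v ≠ 0) :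
    MDifferentiableAt 𝓘(ℝ, Fin (n + 1) → ℂ) 𝓘(ℝ, Fin n → ℂ)
      (ofVec : (Fin (n + 1) → ℂ) → CP n) v :=
  (contMDiffAt_ofVec hv).mdifferentiableAt (by simp)

/-- The derivative at `v` of the projection `ℂⁿ⁺¹ ∖ {0} → CPⁿ`: it represents tangent vectors of
`CPⁿ` at `[v]` by vectors of `ℂⁿ⁺¹`.  The tangent space of `CPⁿ` at `[v]` is written as the model
space `ℂⁿ`, by the preferred chart at `[v]`. -/
def ofVecDeriv (v : Fin (n + 1) → ℂ) : (Fin (n + 1) → ℂ) →L[ℝ] (Fin n → ℂ) :=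
  mfderiv 𝓘(ℝ, Fin (n + 1) → ℂ) 𝓘(ℝ, Fin n → ℂ) (ofVec : (Fin (n + 1) → ℂ) → CP n) v

theorem ofVecDeriv_apply {v : Fin (n + 1) → ℂ} (hv : v ≠ 0) (V : Fin (n + 1) → ℂ) (i : Fin n) :
    ofVecDeriv v V i = (V ((ofVec v).chartIndex.succAbove i) -
      v ((ofVec v).chartIndex.succAbove i) / v (ofVec v).chartIndex * V (ofVec v).chartIndex) /
        v (ofVec v).chartIndex := by
  have hj := apply_chartIndex_ofVec_ne_zero hv
  have hmf := (mdifferentiableAt_ofVec hv).mfderiv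
  simp only [mfld_simps, fderivWithin_univ] at hmf
  replace hmf := hmf.trans (affineChart_comp_ofVec_eventuallyEq hv (ofVec v).chartIndex).fderiv_eq
  refine (congrArg (fun A => A V i) hmf).trans ?_
  set j := (ofVec v).chartIndex
  have hd := (contDiffAt_affineQuotient hj).differentiableAt (n := ∞) (by simp)
  have hline := hasDerivAt_pi.1 (hd.hasFDerivAt.hasLineDerivAt V) i
  have hcoord : ∀ k, HasDerivAt (fun t : ℝ => (v + t • V) k) (V k) 0 := fun k => by
    simpa using ((hasDerivAt_id (0 : ℝ)).smul_const (V k)).const_add (v k)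
  refine (hline.unique ((hcoord (j.succAbove i)).fun_div (hcoord j) (by simpa using hj))).trans ?_
  simp only [Pi.add_apply, zero_smul, Pi.zero_apply, add_zero]
  field_simp

theorem ofVecDeriv_smul_self {v : Fin (n + 1) → ℂ} (hv : v ≠ 0) (c : ℂ) :
    ofVecDeriv v (c • v) = 0 := by
  have hj := apply_chartIndex_ofVec_ne_zero hv
  funext i
  rw [ofVecDeriv_apply hv, Pi.smul_apply, Pi.smul_apply, smul_eq_mul, smul_eq_mul, Pi.zero_apply]
  field_simp
  simp

theorem insertNth_affineChart_ofVec {v : Fin (n + 1) → ℂ} {j : Fin (n + 1)} (hj : v j ≠ 0) :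
    j.insertNth (α := fun _ => ℂ) 1 (affineChart j (ofVec v)) = (v j)⁻¹ • v := by
  rw [affineChart_ofVec (fun h => hj (congrFun h j))]
  funext i
  refine Fin.succAboveCases j ?_ (fun i => ?_) i
  · simp [hj]
  · simp [div_eq_inv_mul]

theorem fubiniStudy_ofVecDeriv {v : Fin (n + 1) → ℂ} (hv : v ≠ 0) (V W : Fin (n + 1) → ℂ) :
    fubiniStudy n (ofVec v) (ofVecDeriv v V) (ofVecDeriv v W) = homogeneousForm v V W := by
  have hj := apply_chartIndex_ofVec_ne_zero hv
  set j := (ofVec v).chartIndex with hjdef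
  have hlift : ∀ V, j.insertNth (α := fun _ => ℂ) 0 (ofVecDeriv v V) =
      (v j)⁻¹ • V + (-(V j / v j ^ 2)) • v := by
    intro V
    funext i
    refine Fin.succAboveCases j ?_ (fun i => ?_) i
    · simp only [Fin.insertNth_apply_same, neg_smul, Pi.add_apply, Pi.smul_apply, smul_eq_mul,
        Pi.neg_apply]
      field_simp
      simp
    · simp only [Fin.insertNth_apply_succAbove, ofVecDeriv_apply hv, ← hjdef, neg_smul,
        Pi.add_apply, Pi.smul_apply, smul_eq_mul, Pi.neg_apply]
      field_simp
      ring
  change homogeneousForm (j.insertNth (α := fun _ => ℂ) 1 (affineChart j (ofVec v)))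
    (j.insertNth 0 (ofVecDeriv v V)) (j.insertNth 0 (ofVecDeriv v W)) = _
  rw [hlift, hlift, insertNth_affineChart_ofVec hj,
    homogeneousForm_descends _ _ _ hv _ _ _ (inv_ne_zero hj)]

/-- The section `[w] ↦ (v_j / w_j) w` of `ofVec` through `v`, for an index `j` with `v_j ≠ 0`. -/
def localSection (v : Fin (n + 1) → ℂ) (p : CP n) : Fin (n + 1) → ℂ :=
  v (ofVec v).chartIndex •
    (ofVec v).chartIndex.insertNth (α := fun _ => ℂ) 1 (affineChart (ofVec v).chartIndex p)

theorem localSection_ofVec {v : Fin (n + 1) → ℂ} (hv : v ≠ 0) :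
    localSection v (ofVec v) = v := by
  have hj := apply_chartIndex_ofVec_ne_zero hv
  rw [localSection, insertNth_affineChart_ofVec hj, smul_inv_smul₀ hj]

theorem ofVec_localSection_eventuallyEq {v : Fin (n + 1) → ℂ} (hv : v ≠ 0) :
    ofVec ∘ localSection v =ᶠ[𝓝 (ofVec v)] id := by
  filter_upwards [(isOpen_affineDomain _).mem_nhds (mem_affineDomain_chartIndex (ofVec v))]
    with p hp
  rw [Function.comp_apply, localSection,
    ofVec_smul (apply_chartIndex_ofVec_ne_zero hv) (insertNth_one_ne_zero _ _),
    ofVec_of_ne_zero (insertNth_one_ne_zero _ _)]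
  exact (affineChart (ofVec v).chartIndex).left_inv hp

theorem contMDiffAt_localSection (v : Fin (n + 1) → ℂ) :
    ContMDiffAt 𝓘(ℝ, Fin n → ℂ) 𝓘(ℝ, Fin (n + 1) → ℂ) ∞ (localSection v) (ofVec v) := by
  have hinsert : ContDiff ℝ ∞ fun w : Fin n → ℂ =>
      v (ofVec v).chartIndex • (ofVec v).chartIndex.insertNth (α := fun _ => ℂ) 1 w := by
    refine ContDiff.const_smul _ (contDiff_pi.2 fun i => ?_)
    refine Fin.succAboveCases (ofVec v).chartIndex ?_ (fun i => ?_) i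
    · simpa using contDiff_const
    · simpa using contDiff_apply ℝ ℂ i
  exact hinsert.contMDiff.contMDiffAt.comp _
    (contMDiffAt_extChartAt (I := 𝓘(ℝ, Fin n → ℂ)) (n := ∞) (x := ofVec v))

theorem ofVecDeriv_surjective {v : Fin (n + 1) → ℂ} (hv : v ≠ 0) :
    Function.Surjective (ofVecDeriv v) := by
  intro u
  have hchain := mfderiv_comp_of_eq (x := ofVec v) (mdifferentiableAt_ofVec hv)
    ((contMDiffAt_localSection v).mdifferentiableAt (by simp)) (localSection_ofVec hv)
  rw [(ofVec_localSection_eventuallyEq hv).mfderiv_eq, mfderiv_id] at hchain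
  obtain ⟨w, hw⟩ : ∃ w, ofVecDeriv (localSection v (ofVec v)) w = u :=
    ⟨_, (congrArg (fun A => A u) hchain).symm⟩
  rw [localSection_ofVec hv] at hw
  exact ⟨w, hw⟩

theorem hasMFDerivAt_ofVec_comp {c : ℝ → Fin (n + 1) → ℂ} {v V : Fin (n + 1) → ℂ} {t : ℝ}
    (hc : HasDerivAt c V t) (hct : c t = v) (hv : v ≠ 0) :
    HasMFDerivAt 𝓘(ℝ, ℝ) 𝓘(ℝ, Fin n → ℂ) (fun s => ofVec (c s)) t
      ((ofVecDeriv v).comp (ContinuousLinearMap.toSpanSingleton ℝ V)) := by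
  subst hct
  exact (mdifferentiableAt_ofVec hv).hasMFDerivAt.comp t hc.hasFDerivAt.hasMFDerivAt

variable {V : Type*} [NormedAddCommGroup V] [NormedSpace ℝ V]

theorem hasDerivAt_comp_ofVec {F : CP n → V} {c : ℝ → Fin (n + 1) → ℂ}
    {v W : Fin (n + 1) → ℂ} {t : ℝ} (hc : HasDerivAt c W t) (hct : c t = v) (hv : v ≠ 0)
    (hF : MDifferentiableAt 𝓘(ℝ, Fin n → ℂ) 𝓘(ℝ, V) F (ofVec v)) :
    HasDerivAt (fun s => F (ofVec (c s)))
      (mfderiv 𝓘(ℝ, Fin n → ℂ) 𝓘(ℝ, V) F (ofVec v) (ofVecDeriv v W)) t := by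
  subst hct
  let D : (Fin n → ℂ) →L[ℝ] V := mfderiv 𝓘(ℝ, Fin n → ℂ) 𝓘(ℝ, V) F (ofVec (c t))
  have h : HasFDerivAt (fun s => F (ofVec (c s)))
      (D.comp ((ofVecDeriv (c t)).comp (ContinuousLinearMap.toSpanSingleton ℝ W))) t :=
    (hF.hasMFDerivAt.comp t (hasMFDerivAt_ofVec_comp hc rfl hv)).hasFDerivAt
  exact h.hasDerivAt.congr_deriv (congrArg (fun w => D (ofVecDeriv (c t) w)) (one_smul ℝ W))

theorem contMDiffAt_of_comp_ofVec {F : CP n → V} {v : Fin (n + 1) → ℂ} (hv : v ≠ 0)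
    (hF : ContDiffAt ℝ ∞ (fun w => F (ofVec w)) v) :
    ContMDiffAt 𝓘(ℝ, Fin n → ℂ) 𝓘(ℝ, V) ∞ F (ofVec v) := by
  refine (ContMDiffAt.comp_of_eq (x := ofVec v) hF.contMDiffAt (contMDiffAt_localSection v)
    (localSection_ofVec hv)).congr_of_eventuallyEq ?_
  filter_upwards [ofVec_localSection_eventuallyEq hv] with p hp
  exact (congrArg F hp).symm

theorem mfderiv_apply_ofVecDeriv {F : CP n → V} {v W : Fin (n + 1) → ℂ} {u : V} (hv : v ≠ 0)
    (hF : MDifferentiableAt 𝓘(ℝ, Fin n → ℂ) 𝓘(ℝ, V) F (ofVec v))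
    (hline : HasDerivAt (fun t : ℝ => F (ofVec (v + t • W))) u 0) :
    mfderiv 𝓘(ℝ, Fin n → ℂ) 𝓘(ℝ, V) F (ofVec v) (ofVecDeriv v W) = u := by
  have hc : HasDerivAt (fun t : ℝ => v + t • W) W 0 := by
    simpa using ((hasDerivAt_id (0 : ℝ)).smul_const W).const_add v
  exact (hasDerivAt_comp_ofVec hc (by simp) hv hF).unique hline

theorem ofVecDeriv_mem_tangentVectors {S : Set (CP n)} {c : ℝ → Fin (n + 1) → ℂ}
    {v V : Fin (n + 1) → ℂ} (hc : ContDiff ℝ ∞ c) (h0 : ∀ t, c t ≠ 0)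
    (hS : ∀ t, ofVec (c t) ∈ S) (hv : c 0 = v) (hV : HasDerivAt c V 0) :
    ofVecDeriv v V ∈ tangentVectors (Fin n → ℂ) S (ofVec v) := by
  subst hv
  refine ⟨fun t => ofVec (c t),
    fun t => (contMDiffAt_ofVec (h0 t)).comp t hc.contMDiff.contMDiffAt, hS, rfl, ?_⟩
  refine (congrArg (fun A => A (1 : ℝ)) (hasMFDerivAt_ofVec_comp hV rfl (h0 0)).mfderiv).trans ?_
  exact congrArg (ofVecDeriv (c 0)) (one_smul ℝ V)

theorem ofVecDeriv_eq_mfderiv_of_lift {γ : ℝ → CP n} {c : ℝ → Fin (n + 1) → ℂ}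
    {v V : Fin (n + 1) → ℂ} {t : ℝ} (hc : HasDerivAt c V t) (hct : c t = v) (hv : v ≠ 0)
    (hγ : γ =ᶠ[𝓝 t] fun s => ofVec (c s)) :
    ofVecDeriv v V = (mfderiv 𝓘(ℝ, ℝ) 𝓘(ℝ, Fin n → ℂ) γ t (1 : ℝ) : Fin n → ℂ) := by
  have h := ((hasMFDerivAt_ofVec_comp hc hct hv).congr_of_eventuallyEq hγ).mfderiv
  refine (congrArg (ofVecDeriv v) (one_smul ℝ V)).symm.trans ?_
  exact (congrArg (fun A : ℝ →L[ℝ] (Fin n → ℂ) => A 1) h).symm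

section RealLocus

variable (Φ : (Fin (n + 1) → ℂ) ≃L[ℂ] (Fin (n + 1) → ℂ))

/-- The vector of `ℂⁿ⁺¹` with real coordinates `r` in the complex linear frame `Φ`. -/
def realVec : (Fin (n + 1) → ℝ) →L[ℝ] (Fin (n + 1) → ℂ) :=
  ((Φ : (Fin (n + 1) → ℂ) →L[ℂ] (Fin (n + 1) → ℂ)).restrictScalars ℝ).comp
    (ContinuousLinearMap.piMap fun _ => Complex.ofRealCLM)

theorem realVec_apply (r : Fin (n + 1) → ℝ) : realVec Φ r = Φ (fun i => (r i : ℂ)) := rfl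

theorem symm_realVec (r : Fin (n + 1) → ℝ) (i : Fin (n + 1)) : Φ.symm (realVec Φ r) i = r i := by
  rw [realVec_apply, Φ.symm_apply_apply]

theorem realVec_ne_zero {r : Fin (n + 1) → ℝ} (hr : r ≠ 0) : realVec Φ r ≠ 0 := by
  refine fun h => hr (funext fun i => ?_)
  simpa [h] using (symm_realVec Φ r i).symm

theorem ofVec_realVec_smul {c : ℝ} (hc : c ≠ 0) {r : Fin (n + 1) → ℝ} (hr : r ≠ 0) :
    ofVec (realVec Φ (c • r)) = ofVec (realVec Φ r) := by
  rw [map_smul, ← Complex.coe_smul]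
  exact ofVec_smul (Complex.ofReal_ne_zero.2 hc) (realVec_ne_zero Φ hr)

/-- The copy of `ℝPⁿ` in `CPⁿ` formed by the points with real homogeneous coordinates in the
complex linear frame `Φ`. -/
def realLocus : Set (CP n) :=
  {p | ∃ r ≠ 0, ofVec (realVec Φ r) = p}

theorem realLocus_eq_image_sphere :
    realLocus Φ = (fun r => ofVec (realVec Φ r)) '' Metric.sphere 0 1 := by
  ext p
  constructor
  · rintro ⟨r, hr, rfl⟩
    refine ⟨‖r‖⁻¹ • r, by simp [norm_smul, hr], ?_⟩
    exact ofVec_realVec_smul Φ (inv_ne_zero (norm_ne_zero_iff.2 hr)) hr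
  · rintro ⟨r, hr, rfl⟩
    exact ⟨r, Metric.ne_of_mem_sphere hr one_ne_zero, rfl⟩

theorem isCompact_realLocus : IsCompact (realLocus Φ) := by
  rw [realLocus_eq_image_sphere]
  refine (isCompact_sphere 0 1).image_of_continuousOn fun r hr => ?_
  have hv := realVec_ne_zero Φ (Metric.ne_of_mem_sphere hr one_ne_zero)
  exact ((continuousAt_ofVec hv).comp (realVec Φ).continuous.continuousAt).continuousWithinAt

/-- The domain of the `k`-th affine chart of the frame `Φ`. -/
def frameDomain (k : Fin (n + 1)) : Set (CP n) :=
  {p | lift (fun v => Φ.symm v k ≠ 0) (by intro v t _ ht; simp [ht]) p}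

/-- The affine coordinates on `frameDomain Φ k`: the `i`-th is the quotient of two homogeneous
coordinates in the frame `Φ`, with the `k`-th as denominator. -/
def frameCoord (k : Fin (n + 1)) : CP n → Fin n → ℂ :=
  lift (fun v i => Φ.symm v (k.succAbove i) / Φ.symm v k) (by
    intro v t _ ht
    funext i
    simp [mul_div_mul_left _ _ ht])

variable {Φ}

theorem ofVec_mem_frameDomain {v : Fin (n + 1) → ℂ} (hv : v ≠ 0) {k : Fin (n + 1)} :
    ofVec v ∈ frameDomain Φ k ↔ Φ.symm v k ≠ 0 := by
  rw [ofVec_of_ne_zero hv]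
  rfl

theorem frameCoord_ofVec {v : Fin (n + 1) → ℂ} (hv : v ≠ 0) (k : Fin (n + 1)) :
    frameCoord Φ k (ofVec v) = fun i => Φ.symm v (k.succAbove i) / Φ.symm v k :=
  lift_ofVec _ _ hv

theorem isOpen_frameDomain (k : Fin (n + 1)) : IsOpen (frameDomain Φ k) := by
  rw [← isQuotientMap_mk.isOpen_preimage]
  have hcont : Continuous fun v : {v : Fin (n + 1) → ℂ // v ≠ 0} => Φ.symm v.1 k :=
    (continuous_apply k).comp (Φ.symm.continuous.comp continuous_subtype_val)
  exact isOpen_ne.preimage hcont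

theorem contDiffAt_frameCoord_ofVec {v : Fin (n + 1) → ℂ} {k : Fin (n + 1)}
    (hk : Φ.symm v k ≠ 0) : ContDiffAt ℝ ∞ (fun w => frameCoord Φ k (ofVec w)) v := by
  have hv : v ≠ 0 := fun h => hk (by simp [h])
  have hsymm : ContDiffAt ℝ ∞ Φ.symm v := (Φ.symm.contDiff.restrict_scalars ℝ).contDiffAt
  refine ((contDiffAt_affineQuotient hk).comp v hsymm).congr_of_eventuallyEq ?_
  filter_upwards [isOpen_ne.mem_nhds hv] with w hw
  exact frameCoord_ofVec hw k

theorem contMDiffAt_frameCoord {p : CP n} {k : Fin (n + 1)} (hp : p ∈ frameDomain Φ k) :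
    ContMDiffAt 𝓘(ℝ, Fin n → ℂ) 𝓘(ℝ, Fin n → ℂ) ∞ (frameCoord Φ k) p := by
  obtain ⟨v, hv, rfl⟩ := exists_eq_ofVec p
  exact contMDiffAt_of_comp_ofVec hv
    (contDiffAt_frameCoord_ofVec ((ofVec_mem_frameDomain hv).1 hp))

theorem frameCoord_ofVec_realVec_im {r : Fin (n + 1) → ℝ} (hr : r ≠ 0) (k : Fin (n + 1))
    (i : Fin n) : (frameCoord Φ k (ofVec (realVec Φ r)) i).im = 0 := by
  rw [frameCoord_ofVec (realVec_ne_zero Φ hr)]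
  simp only [symm_realVec]
  rw [← Complex.ofReal_div, Complex.ofReal_im]

/-- The section of `r ↦ [realVec Φ r]` with `k`-th coordinate `1`, over the part of the real locus
in `frameDomain Φ k`.  The coordinates of a point there are real, so their real parts lose nothing
and make the section total. -/
def realSection (Φ : (Fin (n + 1) → ℂ) ≃L[ℂ] (Fin (n + 1) → ℂ)) (k : Fin (n + 1)) (p : CP n) :
    Fin (n + 1) → ℝ :=
  k.insertNth (α := fun _ => ℝ) 1 fun i => (frameCoord Φ k p i).re

theorem realSection_ne_zero (k : Fin (n + 1)) (p : CP n) : realSection Φ k p ≠ 0 := fun h => by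
  simpa [realSection] using congrFun h k

theorem smul_realSection {r : Fin (n + 1) → ℝ} {k : Fin (n + 1)} (hk : r k ≠ 0) :
    r k • realSection Φ k (ofVec (realVec Φ r)) = r := by
  have hr : r ≠ 0 := fun h => hk (congrFun h k)
  funext i
  refine Fin.succAboveCases k ?_ (fun i => ?_) i
  · simp [realSection]
  · simp only [realSection, frameCoord_ofVec (realVec_ne_zero Φ hr), symm_realVec,
      ← Complex.ofReal_div, Complex.ofReal_re, Pi.smul_apply, Fin.insertNth_apply_succAbove,
      smul_eq_mul]
    field_simp

theorem ofVec_realVec_realSection {p : CP n} {k : Fin (n + 1)} (hp : p ∈ frameDomain Φ k)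
    (him : ∀ i, (frameCoord Φ k p i).im = 0) :
    ofVec (realVec Φ (realSection Φ k p)) = p := by
  obtain ⟨v, hv, rfl⟩ := exists_eq_ofVec p
  have hk := (ofVec_mem_frameDomain hv).1 hp
  rw [ofVec_eq_ofVec_iff (realVec_ne_zero Φ (realSection_ne_zero k _)) hv]
  refine ⟨(Φ.symm v k)⁻¹, Φ.symm.injective (funext fun i => ?_)⟩
  rw [symm_realVec, map_smul]
  refine Fin.succAboveCases k ?_ (fun i => ?_) i
  · simp [realSection, hk]
  · have hre : ((frameCoord Φ k (ofVec v) i).re : ℂ) = frameCoord Φ k (ofVec v) i :=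
      Complex.ext rfl (him i).symm
    rw [realSection, Fin.insertNth_apply_succAbove, hre, frameCoord_ofVec hv]
    exact (div_eq_inv_mul _ _).symm

theorem mem_realLocus_iff_frameCoord_im {p : CP n} {k : Fin (n + 1)} (hp : p ∈ frameDomain Φ k) :
    p ∈ realLocus Φ ↔ ∀ i, (frameCoord Φ k p i).im = 0 := by
  refine ⟨?_, fun him => ⟨_, realSection_ne_zero k p, ofVec_realVec_realSection hp him⟩⟩
  rintro ⟨r, hr, rfl⟩
  exact frameCoord_ofVec_realVec_im hr k

theorem frameCoord_ofVec_add_smul {v : Fin (n + 1) → ℂ} {k : Fin (n + 1)} (hk : Φ.symm v k ≠ 0)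
    (w : Fin n → ℂ) (t : ℝ) :
    frameCoord Φ k (ofVec (v + t • Φ.symm v k • Φ (k.insertNth (α := fun _ => ℂ) 0 w))) =
      frameCoord Φ k (ofVec v) + t • w := by
  set vt := v + t • Φ.symm v k • Φ (k.insertNth (α := fun _ => ℂ) 0 w) with hvt
  have hcoord : Φ.symm vt = Φ.symm v + (t * Φ.symm v k) • k.insertNth (α := fun _ => ℂ) 0 w := by
    rw [hvt, ← Complex.coe_smul, smul_smul, map_add, map_smul, Φ.symm_apply_apply]
  have hcoord_k : Φ.symm vt k = Φ.symm v k := by simp [hcoord]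
  have ne_zero_of_coord : ∀ {x}, Φ.symm x k ≠ 0 → x ≠ 0 := fun hx h => hx (by simp [h])
  funext i
  rw [frameCoord_ofVec (ne_zero_of_coord (hcoord_k ▸ hk)), frameCoord_ofVec (ne_zero_of_coord hk),
    hcoord_k, hcoord]
  simp only [Fin.insertNth_apply_succAbove, Pi.add_apply, Pi.smul_apply, smul_eq_mul,
    Complex.real_smul]
  field_simp

theorem isSmoothSubmanifold_realLocus : IsSmoothSubmanifold (Fin n → ℂ) n (realLocus Φ) := by
  let imL : (Fin n → ℂ) →L[ℝ] (Fin n → ℝ) := ContinuousLinearMap.piMap fun _ => Complex.imCLM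
  have hsmooth : ∀ {k q}, q ∈ frameDomain Φ k →
      ContMDiffAt 𝓘(ℝ, Fin n → ℂ) 𝓘(ℝ, Fin n → ℝ) ∞ (fun p => imL (frameCoord Φ k p)) q :=
    fun hq => imL.contDiff.contMDiff.contMDiffAt.comp _ (contMDiffAt_frameCoord hq)
  intro p hp
  obtain ⟨r, hr, rfl⟩ := hp
  obtain ⟨k, hk⟩ := Function.ne_iff.1 hr
  refine ⟨frameDomain Φ k, fun q => imL (frameCoord Φ k q), isOpen_frameDomain k, ?_,
    fun q hq => (hsmooth hq).contMDiffWithinAt, ?_, ?_⟩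
  · rw [ofVec_mem_frameDomain (realVec_ne_zero Φ hr), symm_realVec]
    exact Complex.ofReal_ne_zero.2 hk
  · rintro q ⟨-, hq⟩ (c : Fin n → ℝ)
    obtain ⟨v, hv, rfl⟩ := exists_eq_ofVec q
    have him : imL (fun i => c i * Complex.I) = c := by
      funext i
      simp [imL]
    have hline : HasDerivAt (fun t : ℝ => imL (frameCoord Φ k (ofVec (v + t • Φ.symm v k •
        Φ (k.insertNth (α := fun _ => ℂ) 0 fun i => c i * Complex.I))))) c 0 := by
      simp only [frameCoord_ofVec_add_smul ((ofVec_mem_frameDomain hv).1 hq), map_add, map_smul,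
        him]
      simpa using
        ((hasDerivAt_id (0 : ℝ)).smul_const c).const_add (imL (frameCoord Φ k (ofVec v)))
    exact ⟨_, mfderiv_apply_ofVecDeriv hv ((hsmooth hq).mdifferentiableAt (by simp)) hline⟩
  · ext q
    rw [mem_inter_iff, and_comm]
    refine and_congr_right fun hq => ?_
    rw [mem_realLocus_iff_frameCoord_im hq, funext_iff]
    rfl

theorem ofVecDeriv_realVec_mem_tangentVectors {r : Fin (n + 1) → ℝ} (hr : r ≠ 0)
    (a : Fin (n + 1) → ℝ) :
    ofVecDeriv (realVec Φ r) (realVec Φ a) ∈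
      tangentVectors (Fin n → ℂ) (realLocus Φ) (ofVec (realVec Φ r)) := by
  obtain ⟨k, hk⟩ := Function.ne_iff.1 hr
  -- Modulo `r` the direction has vanishing `k`-th coordinate, so the line through `r` misses `0`.
  set b := a - (a k / r k) • r with hb
  have hbk : b k = 0 := by
    have : r k ≠ 0 := hk
    simp [hb, this]
  have hderiv :
      ofVecDeriv (realVec Φ r) (realVec Φ a) = ofVecDeriv (realVec Φ r) (realVec Φ b) := by
    rw [hb, map_sub, map_smul, map_sub, ← Complex.coe_smul,
      ofVecDeriv_smul_self (realVec_ne_zero Φ hr), sub_zero]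
  have hne : ∀ t : ℝ, r + t • b ≠ 0 := fun t h => hk (by simpa [hbk] using congrFun h k)
  have hline : HasDerivAt (fun t : ℝ => realVec Φ (r + t • b)) (realVec Φ b) 0 := by
    refine (realVec Φ).hasFDerivAt.comp_hasDerivAt 0 ?_
    simpa using ((hasDerivAt_id (0 : ℝ)).smul_const b).const_add r
  rw [hderiv]
  exact ofVecDeriv_mem_tangentVectors
    ((realVec Φ).contDiff.comp (contDiff_const.add (contDiff_id.smul contDiff_const)))
    (fun t => realVec_ne_zero Φ (hne t)) (fun t => ⟨_, hne t, rfl⟩) (by simp) hline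

theorem exists_realVec_of_mem_tangentVectors {p : CP n} {r : Fin (n + 1) → ℝ} (hr : r ≠ 0)
    (hp : ofVec (realVec Φ r) = p) {u : TangentSpace 𝓘(ℝ, Fin n → ℂ) p}
    (hu : u ∈ tangentVectors (Fin n → ℂ) (realLocus Φ) p) :
    ∃ a, ofVecDeriv (realVec Φ r) (realVec Φ a) = u := by
  obtain ⟨γ, hγ, hγS, rfl, rfl⟩ := hu
  obtain ⟨k, hk⟩ := Function.ne_iff.1 hr
  have hmem : γ 0 ∈ frameDomain Φ k := by
    rw [← hp, ofVec_mem_frameDomain (realVec_ne_zero Φ hr), symm_realVec]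
    exact Complex.ofReal_ne_zero.2 hk
  have hcoord : DifferentiableAt ℝ (fun t => frameCoord Φ k (γ t)) 0 :=
    (((contMDiffAt_frameCoord hmem).comp 0 hγ.contMDiffAt).mdifferentiableAt
      (by simp)).differentiableAt
  -- `γ` lifts to the curve `realVec Φ (ρ t)`, which starts at `realVec Φ r`.
  set ρ : ℝ → Fin (n + 1) → ℝ := fun t => r k • realSection Φ k (γ t)
  have hρ : HasDerivAt ρ (deriv ρ 0) 0 := by
    suffices h : DifferentiableAt ℝ (fun t => realSection Φ k (γ t)) 0 from
      (h.const_smul (r k)).hasDerivAt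
    refine differentiableAt_pi.2 fun i => Fin.succAboveCases k ?_ (fun i => ?_) i
    · simp [realSection]
    · simp only [realSection, Fin.insertNth_apply_succAbove]
      exact Complex.reCLM.differentiableAt.comp 0 (differentiableAt_pi.1 hcoord i)
  have hlift : γ =ᶠ[𝓝 0] fun t => ofVec (realVec Φ (ρ t)) := by
    filter_upwards [hγ.continuous.continuousAt.preimage_mem_nhds
      ((isOpen_frameDomain k).mem_nhds hmem)] with t ht
    rw [ofVec_realVec_smul Φ hk (realSection_ne_zero k _), ofVec_realVec_realSection ht
      ((mem_realLocus_iff_frameCoord_im ht).1 (hγS t))]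
  have hρ0 : ρ 0 = r := by
    simp only [ρ, ← hp]
    exact smul_realSection hk
  exact ⟨deriv ρ 0, ofVecDeriv_eq_mfderiv_of_lift ((realVec Φ).hasFDerivAt.comp_hasDerivAt 0 hρ)
    (congrArg (realVec Φ) hρ0) (realVec_ne_zero Φ hr) hlift⟩

theorem homogeneousForm_eq_zero_of_im_eq_zero {z V W : Fin (n + 1) → ℂ}
    (hzz : (star z ⬝ᵥ z).im = 0) (hVW : (star V ⬝ᵥ W).im = 0) (hVz : (star V ⬝ᵥ z).im = 0)
    (hzW : (star z ⬝ᵥ W).im = 0) : homogeneousForm z V W = 0 := by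
  have hreal : ∀ {c : ℂ}, c.im = 0 → c = c.re := fun hc => Complex.ext rfl hc
  rw [homogeneousForm, hreal hzz, hreal hVW, hreal hVz, hreal hzW]
  norm_cast

theorem isLagrangian_realLocus
    (hΦ : ∀ a b, (star (realVec Φ a) ⬝ᵥ realVec Φ b).im = 0) :
    IsLagrangian (fubiniStudy n) (realLocus Φ) := by
  refine ⟨⟨n, by simp [Module.finrank_pi_fintype, mul_comm], isSmoothSubmanifold_realLocus⟩, ?_⟩
  rintro p ⟨r, hr, rfl⟩ u hu w hw
  obtain ⟨a, rfl⟩ := exists_realVec_of_mem_tangentVectors hr rfl hu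
  obtain ⟨b, rfl⟩ := exists_realVec_of_mem_tangentVectors hr rfl hw
  rw [fubiniStudy_ofVecDeriv (realVec_ne_zero Φ hr)]
  exact homogeneousForm_eq_zero_of_im_eq_zero (hΦ r r) (hΦ a b) (hΦ a r) (hΦ r b)

end RealLocus

section MomentLevel

variable {j : Fin (n + 1)} {a : ℝ}

theorem sum_norm_sq_pos {m : ℕ} {v : Fin m → ℂ} (hv : v ≠ 0) : 0 < ∑ i, ‖v i‖ ^ 2 := by
  obtain ⟨i, hi⟩ := Function.ne_iff.1 hv
  exact Finset.sum_pos' (fun _ _ => sq_nonneg _)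
    ⟨i, Finset.mem_univ i, pow_pos (norm_pos_iff.2 hi) 2⟩

theorem sum_norm_sq_add_smul {m : ℕ} (v w : Fin m → ℂ) (t : ℝ) :
    ∑ i, ‖(v + t • w) i‖ ^ 2 =
      ∑ i, ‖v i‖ ^ 2 + 2 * t * (star v ⬝ᵥ w).re + t ^ 2 * ∑ i, ‖w i‖ ^ 2 := by
  simp only [dotProduct, Complex.re_sum, Finset.mul_sum, ← Finset.sum_add_distrib]
  refine Finset.sum_congr rfl fun i _ => ?_
  simp only [Pi.add_apply, Pi.smul_apply, Pi.star_apply, Complex.star_def, Complex.sq_norm,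
    Complex.normSq_apply, Complex.add_re, Complex.add_im, Complex.smul_re, Complex.smul_im,
    smul_eq_mul, Complex.mul_re, Complex.conj_re, Complex.conj_im]
  ring

theorem moment_ofVec {z : Fin (n + 1) → ℂ} (hz : z ≠ 0) (j : Fin (n + 1)) :
    moment j (ofVec z) =
      -(1 / 2) * (‖z j‖ ^ 2 / (‖z j‖ ^ 2 + ∑ i, ‖j.removeNth z i‖ ^ 2)) := by
  rw [moment, lift_ofVec _ _ hz, Fin.sum_univ_succAbove _ j]
  rfl

theorem moment_ofVec_eq_iff {z : Fin (n + 1) → ℂ} (hz : z ≠ 0) :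
    moment j (ofVec z) = a ↔
      (1 + 2 * a) * ‖z j‖ ^ 2 = -(2 * a) * ∑ i, ‖j.removeNth z i‖ ^ 2 := by
  have hpos := sum_norm_sq_pos hz
  rw [Fin.sum_univ_succAbove _ j] at hpos
  change 0 < ‖z j‖ ^ 2 + ∑ i, ‖j.removeNth z i‖ ^ 2 at hpos
  rw [moment_ofVec hz, ← mul_div_assoc, div_eq_iff hpos.ne']
  constructor <;> intro h <;> linarith

theorem range_moment (j : Fin (n + 2)) :
    range (moment j : CP (n + 1) → ℝ) = Icc (-1 / 2) 0 := by
  refine Subset.antisymm ?_ fun a ha => ?_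
  · rintro _ ⟨p, rfl⟩
    obtain ⟨z, hz, rfl⟩ := exists_eq_ofVec p
    have hle : ‖z j‖ ^ 2 / (‖z j‖ ^ 2 + ∑ i, ‖j.removeNth z i‖ ^ 2) ≤ 1 :=
      div_le_one_of_le₀ (le_add_of_nonneg_right (by positivity)) (by positivity)
    have hnonneg : 0 ≤ ‖z j‖ ^ 2 / (‖z j‖ ^ 2 + ∑ i, ‖j.removeNth z i‖ ^ 2) := by positivity
    rw [moment_ofVec hz]
    constructor <;> linarith
  · have hsqrt : ∀ {x : ℝ}, 0 ≤ x → ‖(√x : ℂ)‖ ^ 2 = x := fun hx => by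
      rw [Complex.norm_real, Real.norm_eq_abs, sq_abs, Real.sq_sqrt hx]
    set z : Fin (n + 2) → ℂ := j.insertNth (√(-(2 * a)) : ℂ) (Pi.single 0 (√(1 + 2 * a) : ℂ))
    have hzj : ‖z j‖ ^ 2 = -(2 * a) := by simpa [z] using hsqrt (by linarith [ha.2])
    have hrest : ∑ i, ‖j.removeNth z i‖ ^ 2 = 1 + 2 * a := by
      have htail : j.removeNth z = Pi.single 0 (√(1 + 2 * a) : ℂ) := Fin.removeNth_insertNth ..
      rw [htail, Fin.sum_univ_succ]
      simpa using hsqrt (by linarith [ha.1])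
    have hz : z ≠ 0 := fun h => by
      have hsum : -(2 * a) + (1 + 2 * a) = 0 := by
        rw [← hzj, ← hrest]
        simp [h, Fin.removeNth]
      linarith
    refine ⟨ofVec z, (moment_ofVec_eq_iff hz).2 ?_⟩
    rw [hzj, hrest]
    ring

theorem apply_ne_zero_of_moment_eq (ha : a ∈ Ioo (-1 / 2) 0) {z : Fin (n + 1) → ℂ} (hz : z ≠ 0)
    (h : moment j (ofVec z) = a) : z j ≠ 0 := by
  intro hj
  rw [moment_ofVec hz, hj] at h
  exact ha.2.ne (by simpa using h.symm)

theorem removeNth_ne_zero_of_moment_eq (ha : a ∈ Ioo (-1 / 2) 0) {z : Fin (n + 1) → ℂ}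
    (hz : z ≠ 0) (h : moment j (ofVec z) = a) : j.removeNth z ≠ 0 := by
  intro htail
  have hj := apply_ne_zero_of_moment_eq ha hz h
  have hnorm : ‖z j‖ ^ 2 ≠ 0 := pow_ne_zero 2 (norm_ne_zero_iff.2 hj)
  have h_min : moment j (ofVec z) = -(1 / 2) := by
    rw [moment_ofVec hz, htail]
    simp [hnorm]
  linarith [ha.1]

theorem contMDiff_moment (j : Fin (n + 1)) :
    ContMDiff 𝓘(ℝ, Fin n → ℂ) 𝓘(ℝ, ℝ) ∞ (moment j : CP n → ℝ) := by
  intro p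
  obtain ⟨z, hz, rfl⟩ := exists_eq_ofVec p
  have hnorm : ∀ k, ContDiffAt ℝ ∞ (fun w : Fin (n + 1) → ℂ => ‖w k‖ ^ 2) z := fun k =>
    ((contDiff_apply ℝ ℂ k).norm_sq ℝ).contDiffAt
  have hformula : ContDiffAt ℝ ∞
      (fun w : Fin (n + 1) → ℂ => -(1 / 2) * (‖w j‖ ^ 2 / ∑ k, ‖w k‖ ^ 2)) z :=
    contDiffAt_const.mul ((hnorm j).div (ContDiffAt.sum fun k _ => hnorm k)
      (sum_norm_sq_pos hz).ne')
  refine contMDiffAt_of_comp_ofVec hz (hformula.congr_of_eventuallyEq ?_)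
  filter_upwards [isOpen_ne.mem_nhds hz] with w hw
  exact lift_ofVec _ _ hw

theorem moment_ofVec_add_smul_removeNth {z : Fin (n + 1) → ℂ} (hj : z j ≠ 0) (t : ℝ) :
    moment j (ofVec (z + t • j.insertNth (α := fun _ => ℂ) 0 (j.removeNth z))) =
      -(1 / 2) * (‖z j‖ ^ 2 / (‖z j‖ ^ 2 + (1 + t) ^ 2 * ∑ i, ‖j.removeNth z i‖ ^ 2)) := by
  set w := z + t • j.insertNth (α := fun _ => ℂ) 0 (j.removeNth z) with hw
  have hwj : w j = z j := by simp [hw]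
  have htail : ∀ i, ‖j.removeNth w i‖ ^ 2 = (1 + t) ^ 2 * ‖j.removeNth z i‖ ^ 2 := fun i => by
    have : j.removeNth w i = ((1 + t : ℝ) : ℂ) * j.removeNth z i := by
      simp only [hw, Fin.removeNth, Pi.add_apply, Pi.smul_apply, Fin.insertNth_apply_succAbove,
        Complex.real_smul, Complex.ofReal_add, Complex.ofReal_one]
      ring
    rw [this, norm_mul, mul_pow, Complex.norm_real, Real.norm_eq_abs, sq_abs]
  rw [moment_ofVec (fun h0 => hj (hwj ▸ congrFun h0 j)), hwj, Finset.mul_sum,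
    Finset.sum_congr rfl fun i _ => htail i]

theorem mfderiv_moment_ne_zero (ha : a ∈ Ioo (-1 / 2) 0) {p : CP n} (hp : moment j p = a) :
    (mfderiv 𝓘(ℝ, Fin n → ℂ) 𝓘(ℝ, ℝ) (moment j) p :
      TangentSpace 𝓘(ℝ, Fin n → ℂ) p →L[ℝ] ℝ) ≠ 0 := by
  obtain ⟨z, hz, rfl⟩ := exists_eq_ofVec p
  have hj := apply_ne_zero_of_moment_eq ha hz hp
  have hx : 0 < ‖z j‖ ^ 2 := pow_pos (norm_pos_iff.2 hj) 2
  have hy := sum_norm_sq_pos (removeNth_ne_zero_of_moment_eq ha hz hp)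
  have hline := (funext (moment_ofVec_add_smul_removeNth hj)).symm
  set x := ‖z j‖ ^ 2
  set y := ∑ i, ‖j.removeNth z i‖ ^ 2
  have hderiv : HasDerivAt (fun t : ℝ => -(1 / 2) * (x / (x + (1 + t) ^ 2 * y)))
      (x * y / (x + y) ^ 2) 0 := by
    have hden : HasDerivAt (fun t : ℝ => x + (1 + t) ^ 2 * y) (2 * y) 0 := by
      simpa using ((((hasDerivAt_id (0 : ℝ)).const_add 1).pow 2).mul_const y).const_add x
    have hquot := ((hasDerivAt_const (0 : ℝ) x).fun_div hden (by positivity)).const_mul (-(1 / 2))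
    refine hquot.congr_deriv ?_
    simp only [add_zero, one_pow, one_mul, zero_mul]
    ring
  rw [hline] at hderiv
  intro hzero
  have h := mfderiv_apply_ofVecDeriv hz ((contMDiff_moment j).mdifferentiableAt (by simp)) hderiv
  rw [hzero] at h
  exact (by positivity : x * y / (x + y) ^ 2 ≠ 0) h.symm

theorem isSmoothSubmanifold_moment_level (ha : a ∈ Ioo (-1 / 2) 0) :
    IsSmoothSubmanifold (Fin n → ℂ) 1 (moment j ⁻¹' {a} : Set (CP n)) :=
  isSmoothSubmanifold_preimage_singleton (contMDiff_moment j) fun _ => mfderiv_moment_ne_zero ha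

/-- The curve with velocity `(0, W)` at `z` whose `j`-th coordinate is stretched just enough for it
to stay in the level set of `moment j` through `z` when `W` is orthogonal to the remaining
coordinates of `z`. -/
def levelCurve (j : Fin (n + 1)) (z : Fin (n + 1) → ℂ) (W : Fin n → ℂ) (t : ℝ) :
    Fin (n + 1) → ℂ :=
  j.insertNth (α := fun _ => ℂ)
    (√(1 + t ^ 2 * ((∑ i, ‖W i‖ ^ 2) / ∑ i, ‖j.removeNth z i‖ ^ 2)) * z j)
    (j.removeNth z + t • W)

theorem levelCurve_scale_pos (j : Fin (n + 1)) (z : Fin (n + 1) → ℂ) (W : Fin n → ℂ) (t : ℝ) :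
    0 < 1 + t ^ 2 * ((∑ i, ‖W i‖ ^ 2) / ∑ i, ‖j.removeNth z i‖ ^ 2) := by
  positivity

theorem levelCurve_ne_zero {z : Fin (n + 1) → ℂ} (hj : z j ≠ 0) (W : Fin n → ℂ) (t : ℝ) :
    levelCurve j z W t ≠ 0 := fun h => by
  have hscale := (Real.sqrt_pos.2 (levelCurve_scale_pos j z W t)).ne'
  simpa [levelCurve, hj, hscale] using congrFun h j

theorem levelCurve_zero (j : Fin (n + 1)) (z : Fin (n + 1) → ℂ) (W : Fin n → ℂ) :
    levelCurve j z W 0 = z := by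
  simp [levelCurve]

theorem moment_ofVec_levelCurve {z : Fin (n + 1) → ℂ} (hj : z j ≠ 0)
    (htail : j.removeNth z ≠ 0) (h : moment j (ofVec z) = a) {W : Fin n → ℂ}
    (hW : (star (j.removeNth z) ⬝ᵥ W).re = 0) (t : ℝ) :
    moment j (ofVec (levelCurve j z W t)) = a := by
  have hz : z ≠ 0 := fun h0 => hj (congrFun h0 j)
  set k := 1 + t ^ 2 * ((∑ i, ‖W i‖ ^ 2) / ∑ i, ‖j.removeNth z i‖ ^ 2) with hk
  have hcoord : ‖levelCurve j z W t j‖ ^ 2 = k * ‖z j‖ ^ 2 := by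
    simp [levelCurve, mul_pow, Real.sq_sqrt (levelCurve_scale_pos j z W t).le, hk]
  have hrest : ∑ i, ‖j.removeNth (levelCurve j z W t) i‖ ^ 2 =
      k * ∑ i, ‖j.removeNth z i‖ ^ 2 := by
    have hpos := sum_norm_sq_pos htail
    rw [levelCurve, Fin.removeNth_insertNth, sum_norm_sq_add_smul, hW, hk]
    field_simp
    ring
  rw [moment_ofVec_eq_iff (levelCurve_ne_zero hj W t), hcoord, hrest]
  linear_combination k * (moment_ofVec_eq_iff hz).1 h

theorem contDiff_levelCurve (j : Fin (n + 1)) (z : Fin (n + 1) → ℂ) (W : Fin n → ℂ) :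
    ContDiff ℝ ∞ (levelCurve j z W) := by
  refine contDiff_pi.2 fun i => Fin.succAboveCases j ?_ (fun i => ?_) i
  · simp only [levelCurve, Fin.insertNth_apply_same]
    have hsqrt : ContDiff ℝ ∞ fun t : ℝ =>
        √(1 + t ^ 2 * ((∑ i, ‖W i‖ ^ 2) / ∑ i, ‖j.removeNth z i‖ ^ 2)) :=
      ContDiff.sqrt (by fun_prop) fun t => (levelCurve_scale_pos j z W t).ne'
    exact (Complex.ofRealCLM.contDiff.comp hsqrt).mul contDiff_const
  · simp only [levelCurve, Fin.insertNth_apply_succAbove, Pi.add_apply, Pi.smul_apply]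
    fun_prop

theorem hasDerivAt_levelCurve (j : Fin (n + 1)) (z : Fin (n + 1) → ℂ) (W : Fin n → ℂ) :
    HasDerivAt (levelCurve j z W) (j.insertNth 0 W) 0 := by
  refine hasDerivAt_pi.2 fun i => Fin.succAboveCases j ?_ (fun i => ?_) i
  · simp only [levelCurve, Fin.insertNth_apply_same]
    have hsq : HasDerivAt (fun t : ℝ =>
        1 + t ^ 2 * ((∑ i, ‖W i‖ ^ 2) / ∑ i, ‖j.removeNth z i‖ ^ 2)) 0 0 := by
      simpa using (((hasDerivAt_id (0 : ℝ)).pow 2).mul_const _).const_add 1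
    simpa using (hsq.sqrt (by simp)).ofReal_comp.mul_const (z j)
  · simp only [levelCurve, Fin.insertNth_apply_succAbove, Pi.add_apply, Pi.smul_apply]
    simpa using ((hasDerivAt_id (0 : ℝ)).smul_const (W i)).const_add (j.removeNth z i)

theorem ofVecDeriv_insertNth_mem_tangentVectors_moment_level (ha : a ∈ Ioo (-1 / 2) 0)
    {z : Fin (n + 1) → ℂ} (hz : z ≠ 0) (h : moment j (ofVec z) = a) {W : Fin n → ℂ}
    (hW : (star (j.removeNth z) ⬝ᵥ W).re = 0) :
    ofVecDeriv z (j.insertNth 0 W) ∈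
      tangentVectors (Fin n → ℂ) (moment j ⁻¹' {a}) (ofVec z) :=
  have hj := apply_ne_zero_of_moment_eq ha hz h
  ofVecDeriv_mem_tangentVectors (contDiff_levelCurve j z W) (levelCurve_ne_zero hj W)
    (moment_ofVec_levelCurve hj (removeNth_ne_zero_of_moment_eq ha hz h) h hW)
    (levelCurve_zero j z W) (hasDerivAt_levelCurve j z W)

theorem exists_ofVecDeriv_insertNth_eq {z : Fin (n + 1) → ℂ} (hj : z j ≠ 0) (u : Fin n → ℂ) :
    ∃ W, ofVecDeriv z (j.insertNth 0 W) = u := by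
  have hz : z ≠ 0 := fun h => hj (congrFun h j)
  obtain ⟨V, rfl⟩ := ofVecDeriv_surjective hz u
  refine ⟨j.removeNth (V - (V j / z j) • z), ?_⟩
  have hV : j.insertNth 0 (j.removeNth (V - (V j / z j) • z)) = V - (V j / z j) • z := by
    rw [Fin.insertNth_eq_iff]
    simp [hj]
  rw [hV, map_sub, ofVecDeriv_smul_self hz, sub_zero]

theorem intersectTransversally_moment_level {S : Set (CP n)} {c : ℕ}
    (hS : IsSmoothSubmanifold (Fin n → ℂ) c S) (ha : a ∈ Ioo (-1 / 2) 0)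
    (hradial : ∀ p ∈ S, moment j p = a → ∃ z ≠ 0, ofVec z = p ∧
      ∃ W : Fin n → ℂ, (star (j.removeNth z) ⬝ᵥ W).re ≠ 0 ∧ ∀ s : ℝ,
        ofVecDeriv z (j.insertNth 0 (s • W)) ∈ tangentVectors (Fin n → ℂ) S (ofVec z)) :
    IntersectTransversally (Fin n → ℂ) c 1 S (moment j ⁻¹' {a}) := by
  refine ⟨hS, isSmoothSubmanifold_moment_level ha, ?_⟩
  rintro p ⟨hpS, hpa⟩ (u : Fin n → ℂ)
  obtain ⟨z, hz, rfl, W, hW, htangent⟩ := hradial p hpS hpa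
  obtain ⟨V, rfl⟩ := exists_ofVecDeriv_insertNth_eq (apply_ne_zero_of_moment_eq ha hz hpa) u
  set s := (star (j.removeNth z) ⬝ᵥ V).re / (star (j.removeNth z) ⬝ᵥ W).re with hs
  have horth : (star (j.removeNth z) ⬝ᵥ (V - s • W)).re = 0 := by
    rw [dotProduct_sub, dotProduct_smul, Complex.sub_re, Complex.smul_re, smul_eq_mul, hs,
      div_mul_cancel₀ _ hW, sub_self]
  refine ⟨_, htangent s, _,
    ofVecDeriv_insertNth_mem_tangentVectors_moment_level ha hz hpa horth, ?_⟩
  refine (map_add (ofVecDeriv z) _ _).symm.trans ?_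
  rw [← insertNth_zero_add, add_sub_cancel]

end MomentLevel

end CP

open CP

/-- The linear frame of `ℂ³` in which `lagrangianL2` is the real projective plane: the
complexification of `lagrangianVec`. -/
def chiangFrame : (Fin (2 + 1) → ℂ) ≃L[ℂ] (Fin (2 + 1) → ℂ) :=
  LinearEquiv.toContinuousLinearEquiv
    { toFun := fun x => ![x 0 - Complex.I * x 1, (√2 : ℝ) * Complex.I * x 2,
        x 0 + Complex.I * x 1]
      invFun := fun z => ![(z 0 + z 2) / 2, Complex.I * (z 0 - z 2) / 2,
        -Complex.I * z 1 / (√2 : ℝ)]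
      map_add' := fun x y => by
        funext i
        fin_cases i <;> simp <;> ring
      map_smul' := fun c x => by
        funext i
        fin_cases i <;> simp <;> ring
      left_inv := fun x => by
        funext i
        fin_cases i
        · change (x 0 - Complex.I * x 1 + (x 0 + Complex.I * x 1)) / 2 = x 0
          ring
        · change Complex.I * (x 0 - Complex.I * x 1 - (x 0 + Complex.I * x 1)) / 2 = x 1
          linear_combination -x 1 * Complex.I_sq
        · change -Complex.I * ((√2 : ℝ) * Complex.I * x 2) / (√2 : ℝ) = x 2
          field_simp
          linear_combination -x 2 * Complex.I_sq
      right_inv := fun z => by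
        funext i
        fin_cases i
        · change (z 0 + z 2) / 2 - Complex.I * (Complex.I * (z 0 - z 2) / 2) = z 0
          linear_combination -(z 0 - z 2) / 2 * Complex.I_sq
        · change (√2 : ℝ) * Complex.I * (-Complex.I * z 1 / (√2 : ℝ)) = z 1
          field_simp
          linear_combination -z 1 * Complex.I_sq
        · change (z 0 + z 2) / 2 + Complex.I * (Complex.I * (z 0 - z 2) / 2) = z 2
          linear_combination (z 0 - z 2) / 2 * Complex.I_sq }

theorem chiangFrame_symm_apply (z : Fin 3 → ℂ) :
    chiangFrame.symm z =
      ![(z 0 + z 2) / 2, Complex.I * (z 0 - z 2) / 2, -Complex.I * z 1 / (√2 : ℝ)] := rfl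

theorem realVec_chiangFrame (r : Fin 3 → ℝ) :
    realVec chiangFrame r = lagrangianVec (r 0) (r 1) (r 2) := rfl

theorem lagrangianL2_eq_realLocus : lagrangianL2 = realLocus chiangFrame := by
  ext p
  constructor
  · rintro ⟨X, Y, Z, h, rfl⟩
    refine ⟨![X, Y, Z], ?_, ofVec_of_ne_zero (lagrangianVec_ne_zero h)⟩
    intro h0
    have hX : X = 0 := congrFun h0 0
    have hY : Y = 0 := congrFun h0 1
    have hZ : Z = 0 := congrFun h0 2
    simp [hX, hY, hZ] at h
  · rintro ⟨r, hr, rfl⟩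
    have hpos : 0 < r 0 ^ 2 + r 1 ^ 2 + r 2 ^ 2 := by
      obtain ⟨i, hi⟩ := Function.ne_iff.1 hr
      have hsum : 0 < ∑ i : Fin 3, r i ^ 2 := Finset.sum_pos' (fun _ _ => sq_nonneg _)
        ⟨i, Finset.mem_univ i, pow_two_pos_of_ne_zero hi⟩
      rwa [Fin.sum_univ_three] at hsum
    set c := (√(r 0 ^ 2 + r 1 ^ 2 + r 2 ^ 2))⁻¹ with hc
    have hunit : (c * r 0) ^ 2 + (c * r 1) ^ 2 + (c * r 2) ^ 2 = 1 := by
      rw [mul_pow, mul_pow, mul_pow, ← mul_add, ← mul_add, hc, inv_pow, Real.sq_sqrt hpos.le,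
        inv_mul_cancel₀ hpos.ne']
    refine ⟨c * r 0, c * r 1, c * r 2, hunit, ?_⟩
    rw [← ofVec_realVec_smul _ (inv_ne_zero (Real.sqrt_pos.2 hpos).ne') hr]
    exact ofVec_of_ne_zero (lagrangianVec_ne_zero hunit)

theorem star_realVec_chiangFrame_dotProduct (a b : Fin 3 → ℝ) :
    star (realVec chiangFrame a) ⬝ᵥ realVec chiangFrame b = ((2 * (a ⬝ᵥ b) : ℝ) : ℂ) := by
  have hsqrt : ((√2 : ℝ) : ℂ) ^ 2 = 2 := by
    rw [← Complex.ofReal_pow, Real.sq_sqrt zero_le_two, Complex.ofReal_ofNat]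
  rw [dotProduct, dotProduct, Fin.sum_univ_three, Fin.sum_univ_three]
  simp only [realVec_chiangFrame, lagrangianVec, Pi.star_apply, Complex.star_def,
    Matrix.cons_val_zero, Matrix.cons_val_one, Matrix.cons_val, map_sub, map_add, map_mul,
    Complex.conj_ofReal, Complex.conj_I, Complex.ofReal_mul, Complex.ofReal_add,
    Complex.ofReal_ofNat]
  linear_combination (-2 * a 1 * b 1 - ((√2 : ℝ) : ℂ) ^ 2 * a 2 * b 2) * Complex.I_sq +
    a 2 * b 2 * hsqrt

theorem isCompact_lagrangianL2 : IsCompact lagrangianL2 :=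
  lagrangianL2_eq_realLocus ▸ isCompact_realLocus chiangFrame

theorem isLagrangian_lagrangianL2 : IsLagrangian (fubiniStudy 2) lagrangianL2 := by
  rw [lagrangianL2_eq_realLocus]
  refine isLagrangian_realLocus fun a b => ?_
  exact (congrArg Complex.im (star_realVec_chiangFrame_dotProduct a b)).trans (Complex.ofReal_im _)

theorem norm_eq_norm_of_mem_lagrangianL2 {v : Fin 3 → ℂ} (hv : v ≠ 0)
    (h : ofVec v ∈ lagrangianL2) : ‖v 0‖ = ‖v 2‖ := by
  obtain ⟨r, hr, h⟩ := lagrangianL2_eq_realLocus ▸ h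
  obtain ⟨c, rfl⟩ := (ofVec_eq_ofVec_iff hv (realVec_ne_zero _ hr)).1 h.symm
  have hconj : realVec chiangFrame r 0 = star (realVec chiangFrame r 2) := by
    simp [realVec_chiangFrame, lagrangianVec, sub_eq_add_neg]
  rw [Pi.smul_apply, Pi.smul_apply, norm_smul, norm_smul, hconj, norm_star]

theorem frameCoord_chiangFrame_two_ofVec {v : Fin 3 → ℂ} (h1 : v 1 ≠ 0) :
    frameCoord chiangFrame 2 (ofVec v) =
      (√2 / 2 : ℝ) • ![Complex.I * (v 0 + v 2) / v 1, (v 2 - v 0) / v 1] := by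
  have hv : v ≠ 0 := fun h => h1 (congrFun h 1)
  rw [frameCoord_ofVec hv, chiangFrame_symm_apply]
  funext i
  fin_cases i
  · change (v 0 + v 2) / 2 / (-Complex.I * v 1 / (√2 : ℝ)) =
      (√2 / 2 : ℝ) * (Complex.I * (v 0 + v 2) / v 1)
    rw [neg_mul, neg_div, div_neg]
    push_cast
    field_simp
    linear_combination -(v 0 + v 2) * Complex.I_sq
  · change Complex.I * (v 0 - v 2) / 2 / (-Complex.I * v 1 / (√2 : ℝ)) =
      (√2 / 2 : ℝ) * ((v 2 - v 0) / v 1)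
    push_cast
    field_simp
    ring

theorem ofVec_mem_lagrangianL2_iff {v : Fin 3 → ℂ} (h1 : v 1 ≠ 0) :
    ofVec v ∈ lagrangianL2 ↔ v 0 * star (v 1) + v 1 * star (v 2) = 0 := by
  have hdomain : ofVec v ∈ frameDomain chiangFrame 2 := by
    have hv : v ≠ 0 := fun h => h1 (congrFun h 1)
    simpa [ofVec_mem_frameDomain hv, chiangFrame_symm_apply] using h1
  have him (x : ℂ) : ((√2 / 2 : ℝ) • (x / v 1)).im = 0 ↔ (x * star (v 1)).im = 0 := by
    have hdiv : x / v 1 = ((Complex.normSq (v 1))⁻¹ : ℝ) * (x * star (v 1)) := by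
      rw [div_eq_mul_inv, Complex.inv_def, Complex.star_def]
      ring
    rw [hdiv, Complex.smul_im, Complex.im_ofReal_mul]
    simp [h1]
  have hreal : (Complex.I * (v 0 + v 2) * star (v 1)).im =
      (v 0 * star (v 1) + v 1 * star (v 2)).re := by
    simp only [Complex.star_def, Complex.mul_re, Complex.mul_im, Complex.add_re, Complex.add_im,
      Complex.conj_re, Complex.conj_im, Complex.I_re, Complex.I_im]
    ring
  have himag : ((v 2 - v 0) * star (v 1)).im = -(v 0 * star (v 1) + v 1 * star (v 2)).im := by
    simp only [Complex.star_def, Complex.mul_im, Complex.sub_re, Complex.sub_im, Complex.add_im,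
      Complex.conj_re, Complex.conj_im]
    ring
  rw [lagrangianL2_eq_realLocus, mem_realLocus_iff_frameCoord_im hdomain, Fin.forall_fin_two,
    frameCoord_chiangFrame_two_ofVec h1]
  refine (and_congr (him _) (him _)).trans ?_
  rw [hreal, himag, neg_eq_zero, Complex.ext_iff, Complex.zero_re, Complex.zero_im]

theorem ofVec_mem_level_iff {v : Fin 3 → ℂ} (hv : v ≠ 0) :
    ofVec v ∈ mu2 ⁻¹' {-1 / 6} ↔ ‖v 0‖ ^ 2 + ‖v 1‖ ^ 2 = 2 * ‖v 2‖ ^ 2 := by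
  rw [ofVec_of_ne_zero hv, level_iff]

theorem apply_two_ne_zero_of_level {v : Fin 3 → ℂ} (hv : v ≠ 0)
    (hl : ofVec v ∈ mu2 ⁻¹' {-1 / 6}) : v 2 ≠ 0 :=
  apply_ne_zero_of_moment_eq (by norm_num) hv hl

theorem moment_one_eq_iff_of_level {v : Fin 3 → ℂ} (hv : v ≠ 0)
    (hl : ofVec v ∈ mu2 ⁻¹' {-1 / 6}) :
    moment 1 (ofVec v) = -1 / 6 ↔ ‖v 0‖ = ‖v 1‖ := by
  rw [ofVec_mem_level_iff hv] at hl
  rw [moment_ofVec_eq_iff hv, Fin.sum_univ_two, ← sq_eq_sq₀ (norm_nonneg _) (norm_nonneg _)]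
  change (1 + 2 * (-1 / 6)) * ‖v 1‖ ^ 2 = -(2 * (-1 / 6)) * (‖v 0‖ ^ 2 + ‖v 2‖ ^ 2) ↔ _
  constructor <;> intro h <;> linarith

theorem norm_eq_norm_of_mem_lagrangianL2_of_level {v : Fin 3 → ℂ} (hv : v ≠ 0)
    (hL : ofVec v ∈ lagrangianL2) (hl : ofVec v ∈ mu2 ⁻¹' {-1 / 6}) : ‖v 0‖ = ‖v 1‖ := by
  rw [ofVec_mem_level_iff hv, ← norm_eq_norm_of_mem_lagrangianL2 hv hL] at hl
  rw [← sq_eq_sq₀ (norm_nonneg _) (norm_nonneg _)]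
  linarith

theorem apply_one_ne_zero_of_level {v : Fin 3 → ℂ} (hv : v ≠ 0)
    (hl : ofVec v ∈ mu2 ⁻¹' {-1 / 6}) (h01 : ‖v 0‖ = ‖v 1‖) : v 1 ≠ 0 := by
  intro h1
  have h2 := apply_two_ne_zero_of_level hv hl
  rw [ofVec_mem_level_iff hv, h01, h1] at hl
  simp [h2] at hl

theorem insertNth_two_smul_realVec_chiangFrame (r : Fin 3 → ℝ) (s : ℝ) :
    Fin.insertNth (α := fun _ => ℂ) 2 0 (s • ![0, realVec chiangFrame r 1]) =
      realVec chiangFrame ![0, 0, s * r 2] := by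
  funext i
  fin_cases i
  · change (s : ℂ) * 0 = (0 : ℝ) - Complex.I * (0 : ℝ)
    simp
  · change (s : ℂ) * ((√2 : ℝ) * Complex.I * r 2) = (√2 : ℝ) * Complex.I * (s * r 2 : ℝ)
    push_cast
    ring
  · change (0 : ℂ) = (0 : ℝ) + Complex.I * (0 : ℝ)
    simp

theorem intersectTransversally_lagrangianL2_level :
    IntersectTransversally (Fin 2 → ℂ) 2 1 lagrangianL2 (mu2 ⁻¹' {-1 / 6}) := by
  refine intersectTransversally_moment_level ?_ (by norm_num) fun p hp hl => ?_
  · exact lagrangianL2_eq_realLocus ▸ isSmoothSubmanifold_realLocus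
  obtain ⟨r, hr, rfl⟩ := lagrangianL2_eq_realLocus ▸ hp
  have hz := realVec_ne_zero chiangFrame hr
  have hz1 : realVec chiangFrame r 1 ≠ 0 :=
    apply_one_ne_zero_of_level hz hl (norm_eq_norm_of_mem_lagrangianL2_of_level hz hp hl)
  refine ⟨realVec chiangFrame r, hz, rfl, ![0, realVec chiangFrame r 1], ?_, fun s => ?_⟩
  · have hdot : star (Fin.removeNth 2 (realVec chiangFrame r)) ⬝ᵥ ![0, realVec chiangFrame r 1] =
        star (realVec chiangFrame r 1) * realVec chiangFrame r 1 := by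
      rw [dotProduct, Fin.sum_univ_two]
      exact (congrArg (· + _) (mul_zero _)).trans (zero_add _)
    rw [hdot, Complex.star_def, ← Complex.normSq_eq_conj_mul_self, Complex.ofReal_re]
    exact Complex.normSq_eq_zero.not.2 hz1
  · rw [insertNth_two_smul_realVec_chiangFrame, lagrangianL2_eq_realLocus]
    exact ofVecDeriv_realVec_mem_tangentVectors hr _

theorem smul_ofVec (g : Circle) {v : Fin 3 → ℂ} (hv : v ≠ 0) :
    g • ofVec v = ofVec (rotateLinear g v) := by
  rw [ofVec_of_ne_zero hv, smul_mk, ofVec_of_ne_zero (rotateLinear_ne_zero g hv)]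

theorem injOn_orbitProj_lagrangianL2 :
    InjOn (orbitProj Circle mu2 (-1 / 6)) {x | (x : CP 2) ∈ lagrangianL2} := by
  rintro ⟨p, hp⟩ hpL ⟨q, hq⟩ hqL h
  obtain ⟨g, rfl : g • q = p⟩ := Quotient.exact h
  obtain ⟨v, hv, rfl⟩ := exists_eq_ofVec q
  have h1 := apply_one_ne_zero_of_level hv hq (norm_eq_norm_of_mem_lagrangianL2_of_level hv hqL hq)
  have h2 := apply_two_ne_zero_of_level hv hq
  have hv_rel := (ofVec_mem_lagrangianL2_iff h1).1 hqL
  have hgv_rel : v 0 * star (v 1) + v 1 * star (g * v 2) = 0 :=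
    (ofVec_mem_lagrangianL2_iff (v := rotateLinear g v) h1).1 (smul_ofVec g hv ▸ hpL)
  have hstar : star (g * v 2) = star (v 2) :=
    mul_left_cancel₀ h1 (by linear_combination hgv_rel - hv_rel)
  have hg : g = 1 := Circle.ext (mul_right_cancel₀ h2 (by simpa using star_injective hstar))
  simp [hg]

theorem exists_mem_lagrangianL2_orbitProj_eq {v : Fin 3 → ℂ} (hv : v ≠ 0)
    (hl : ofVec v ∈ mu2 ⁻¹' {-1 / 6}) (h01 : ‖v 0‖ = ‖v 1‖) :
    ∃ x : mu2 ⁻¹' {(-1 / 6 : ℝ)}, (x : CP 2) ∈ lagrangianL2 ∧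
      orbitProj Circle mu2 (-1 / 6) x = orbitProj Circle mu2 (-1 / 6) ⟨ofVec v, hl⟩ := by
  have h1 := apply_one_ne_zero_of_level hv hl h01
  set w : Fin 3 → ℂ := ![v 0, v 1, -(star (v 0) * v 1) / star (v 1)] with hw
  have hw0 : w ≠ 0 := fun h => h1 (congrFun h 1)
  have hwl : ofVec w ∈ mu2 ⁻¹' {-1 / 6} := by
    have hw2 : ‖w 2‖ = ‖v 1‖ := by simp [hw, h01, h1]
    rw [ofVec_mem_level_iff hw0, hw2]
    change ‖v 0‖ ^ 2 + ‖v 1‖ ^ 2 = _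
    rw [h01, two_mul]
  refine ⟨⟨ofVec w, hwl⟩, (ofVec_mem_lagrangianL2_iff (v := w) h1).2 ?_, Quotient.sound ?_⟩
  · change v 0 * star (v 1) + v 1 * star (-(star (v 0) * v 1) / star (v 1)) = 0
    rw [star_div₀, star_neg, star_mul', star_star, star_star]
    field_simp
    ring
  · rw [ofVec_of_ne_zero hv] at hl
    rw [ofVec_of_ne_zero hw0] at hwl
    obtain ⟨g, hg⟩ := exists_rotate hw0 hv hwl hl 1 one_ne_zero (one_mul _).symm (one_mul _).symm
    refine ⟨g, ?_⟩
    change g • ofVec v = ofVec w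
    rw [ofVec_of_ne_zero hv, ofVec_of_ne_zero hw0, hg]

theorem exists_orbitProj_ofVec_eq (y : Reduced) :
    ∃ (v : Fin 3 → ℂ) (_ : v ≠ 0) (hl : ofVec v ∈ mu2 ⁻¹' {-1 / 6}),
      orbitProj Circle mu2 (-1 / 6) ⟨ofVec v, hl⟩ = y := by
  obtain ⟨⟨p, hp⟩, rfl⟩ := Quotient.exists_rep y
  obtain ⟨v, hv, rfl⟩ := exists_eq_ofVec p
  exact ⟨v, hv, hp, rfl⟩

theorem image_orbitProj_lagrangianL2 :
    orbitProj Circle mu2 (-1 / 6) '' {x | (x : CP 2) ∈ lagrangianL2} = muRed ⁻¹' {-1 / 6} := by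
  ext y
  constructor
  · rintro ⟨⟨p, hl⟩, hL, rfl⟩
    obtain ⟨v, hv, rfl⟩ := exists_eq_ofVec p
    exact (moment_one_eq_iff_of_level hv hl).2 (norm_eq_norm_of_mem_lagrangianL2_of_level hv hL hl)
  · intro hy
    obtain ⟨v, hv, hl, rfl⟩ := exists_orbitProj_ofVec_eq y
    exact exists_mem_lagrangianL2_orbitProj_eq hv hl ((moment_one_eq_iff_of_level hv hl).1 hy)

theorem isOneToOneTransverseLifting_lagrangianL2 :
    IsOneToOneTransverseLifting (fubiniStudy 2) mu2 (-1 / 6) lagrangianL2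
      (muRed ⁻¹' {-1 / 6}) where
  isCompact := isCompact_lagrangianL2
  isLagrangian := isLagrangian_lagrangianL2
  transverse := by
    simpa [Module.finrank_pi_fintype] using intersectTransversally_lagrangianL2_level
  injOn := injOn_orbitProj_lagrangianL2
  eq_image := image_orbitProj_lagrangianL2.symm

theorem reducedHomeomorph_orbitProj_ofVec {v : Fin 3 → ℂ} (hv : v ≠ 0)
    (hl : ofVec v ∈ mu2 ⁻¹' {-1 / 6}) :
    reducedHomeomorph (orbitProj Circle mu2 (-1 / 6) ⟨ofVec v, hl⟩) = ofVec ![v 0, v 1] := by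
  have hhead := head_ne_zero_of_level v hv (ofVec_of_ne_zero hv ▸ hl)
  rw [ofVec_of_ne_zero hhead, ← forgetLast_mk v hv hhead, ← ofVec_of_ne_zero hv]
  rfl

theorem muRed_eq_moment_reducedHomeomorph (y : Reduced) :
    muRed y = 2 / 3 * moment 1 (reducedHomeomorph y) := by
  obtain ⟨v, hv, hl, rfl⟩ := exists_orbitProj_ofVec_eq y
  have hhead := head_ne_zero_of_level v hv (ofVec_of_ne_zero hv ▸ hl)
  have h2 : ‖v 2‖ ≠ 0 := norm_ne_zero_iff.2 (apply_two_ne_zero_of_level hv hl)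
  have hnorm := (ofVec_mem_level_iff hv).1 hl
  have hmoment : moment 1 (ofVec v) =
      -(1 / 2) * (‖v 1‖ ^ 2 / (‖v 1‖ ^ 2 + (‖v 0‖ ^ 2 + ‖v 2‖ ^ 2))) := by
    rw [moment_ofVec hv, Fin.sum_univ_two]
    rfl
  have hmoment_head : moment 1 (ofVec ![v 0, v 1]) =
      -(1 / 2) * (‖v 1‖ ^ 2 / (‖v 1‖ ^ 2 + ‖v 0‖ ^ 2)) := by
    rw [moment_ofVec hhead, Fin.sum_univ_one]
    rfl
  rw [reducedHomeomorph_orbitProj_ofVec hv hl, hmoment_head]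
  refine hmoment.trans ?_
  have hsum : ‖v 1‖ ^ 2 + (‖v 0‖ ^ 2 + ‖v 2‖ ^ 2) = 3 * ‖v 2‖ ^ 2 := by linarith
  have hsum_head : ‖v 1‖ ^ 2 + ‖v 0‖ ^ 2 = 2 * ‖v 2‖ ^ 2 := by linarith
  rw [hsum, hsum_head]
  field_simp

theorem inner_single_two_hopf (p : CP 1) :
    inner ℝ (EuclideanSpace.single 2 1) (hopf p) = 1 + 4 * moment 1 p := by
  obtain ⟨w, hw, rfl⟩ := exists_eq_ofVec p
  have hpos := sum_norm_sq_pos hw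
  rw [moment, hopf, lift_ofVec _ _ hw, lift_ofVec _ _ hw]
  simp only [Nat.reduceAdd, Fin.sum_univ_two, EuclideanSpace.inner_single_left, map_one,
    PiLp.smul_apply, Matrix.cons_val, smul_eq_mul, one_mul] at hpos ⊢
  field_simp
  ring

theorem isGreatCircle_image_middle_level :
    IsGreatCircle (reducedHomeomorph '' (muRed ⁻¹' {-1 / 6})) := by
  refine ⟨EuclideanSpace.single 2 1, by simp, ?_⟩
  rw [reducedHomeomorph.image_eq_preimage_symm]
  ext p
  rw [mem_preimage, mem_preimage, mem_singleton_iff, muRed_eq_moment_reducedHomeomorph,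
    Homeomorph.apply_symm_apply, mem_ofPred_eq, inner_single_two_hopf]
  constructor <;> intro h <;> linarith

theorem range_muRed : range muRed = Icc (-1 / 3) 0 := by
  have hcomp : muRed = (fun x => 2 / 3 * x) ∘ moment 1 ∘ reducedHomeomorph :=
    funext muRed_eq_moment_reducedHomeomorph
  rw [hcomp, range_comp, reducedHomeomorph.surjective.range_comp, range_moment,
    image_mul_left_Icc (by norm_num) (by norm_num)]
  norm_num

end

end ChiangLagrangian

theorem mainTheorem1 :
    ∃ ℓ₂ : Set Reduced,
      IsOneToOneTransverseLifting (fubiniStudy 2) mu2 (-1 / 6) lagrangianL2 ℓ₂ ∧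
      IsGreatCircle (reducedHomeomorph '' ℓ₂) ∧
      Set.range muRed = Set.Icc (-1 / 3) 0 ∧
      ℓ₂ = muRed ⁻¹' {-1 / 6} :=
  ⟨_, isOneToOneTransverseLifting_lagrangianL2, isGreatCircle_image_middle_level, range_muRed, rfl⟩
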